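/- A discrete memoryless broadcast interference channel (DM-BIC) has finite input alphabets $\mathcal X_1,\mathcal X_2$, finite output alphabets $\mathcal Y_1,\mathcal Y_2,\mathcal Y_3$ and transition probability $p(y_1,y_2,y_3|x_1,x_2)=p(y_1|x_1)\,p(y_2|x_1,x_2)\,p(y_3|x_2)$; the channel is used $n$ times without memory. An $(M_1,M_2,M_3,n)$ code consists of nonempty message sets $\mathcal W_j=\{1,\dots,M_j\}$ ($j=1,2,3$), encoders $\mathcal W_1\times\mathcal W_2\to\mathcal X_1^n$ and $\mathcal W_3\to\mathcal X_2^n$, and decoders $g_j:\mathcal Y_j^n\to\mathcal W_j$. Its rates are $\frac{\log_2 M_j}{n}$, and its error probability is $P_e=\Pr(g_1(Y_1^n)\ne W_1\text{ or }g_2(Y_2^n)\ne W_2\text{ or }g_3(Y_3^n)\ne W_3)$ for independent messages $W_j$ uniform on $\mathcal W_j$. A triple $(R_1,R_2,R_3)$ is achievable if there are codes, one for each blocklength $n$, whose rates tend to $(R_1,R_2,R_3)$ and whose error probabilities tend to $0$ as $n\to\infty$. Mutual information is measured in bits. Write $Y_1\prec_o Y_2$ if $I(U_1;Y_1)\le I(U_1;Y_2)$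 for every random variable $U_1$ with a finite alphabet and every input law $p(u_1,x_1)p(x_2)$ such that $U_1\to(X_1,X_2)\to(Y_1,Y_2)$ is a Markov chain. Theorem. Consider a DM-BIC with $Y_1\prec_o Y_2$. Let $\mathcal R_{(1)}$ be the closure of the set of all $(R_1,R_2,R_3)$ with $R_1,R_2,R_3\ge 0$ and $$\begin{aligned} R_1&\le I(U_1;Y_1),\\ R_2&\le I(X_1;Y_2|U_1,U_2),\\ R_3&\le I(X_2;Y_3),\\ R_2+R_3&\le I(X_1,U_2;Y_2|U_1)+I(X_2;Y_3|U_2) \end{aligned}$$ for some random variables $U_1,U_2$ with finite alphabets and some joint law $p(u_1)p(x_1|u_1)p(u_2)p(x_2|u_2)\,p(y_1,y_2,y_3|x_1,x_2)$ of $(U_1,X_1,U_2,X_2,Y_1,Y_2,Y_3)$. Then every $(R_1,R_2,R_3)\in\mathcal R_{(1)}$ is achievable. -/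

import Mathlib

open Filter Topology

/-! Information measures (in bits) of random variables on a finite probability space `(Ω, p)`. -/

/-- The probability mass function of the random variable `A` under the mass function `p`. -/
noncomputable def lawOf {Ω α : Type*} [Fintype Ω] (p : Ω → ℝ) (A : Ω → α) (a : α) : ℝ :=
  open Classical in ∑ ω, if A ω = a then p ω else 0

/-- Mutual information `I(A;B) = ∑ p(a,b) log₂ (p(a,b) / (p(a) p(b)))`; terms with `p(a,b) = 0`
vanish. -/
noncomputable def mutualInfo {Ω α β : Type*} [Fintype Ω] [Fintype α] [Fintype β]
    (p : Ω → ℝ) (A : Ω → α) (B : Ω → β) : ℝ :=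
  ∑ a, ∑ b, lawOf p (fun ω => (A ω, B ω)) (a, b) *
    Real.logb 2 (lawOf p (fun ω => (A ω, B ω)) (a, b) / (lawOf p A a * lawOf p B b))

/-- Conditional mutual information
`I(A;B|C) = ∑ p(a,b,c) log₂ (p(a,b|c) / (p(a|c) p(b|c)))
          = ∑ p(a,b,c) log₂ (p(a,b,c) p(c) / (p(a,c) p(b,c)))`;
terms with `p(a,b,c) = 0` vanish. -/
noncomputable def condMutualInfo {Ω α β γ : Type*} [Fintype Ω] [Fintype α] [Fintype β] [Fintype γ]
    (p : Ω → ℝ) (A : Ω → α) (B : Ω → β) (C : Ω → γ) : ℝ :=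
  ∑ a, ∑ b, ∑ c, lawOf p (fun ω => (A ω, B ω, C ω)) (a, b, c) *
    Real.logb 2 (lawOf p (fun ω => (A ω, B ω, C ω)) (a, b, c) * lawOf p C c /
      (lawOf p (fun ω => (A ω, C ω)) (a, c) * lawOf p (fun ω => (B ω, C ω)) (b, c)))

/-- A discrete memoryless broadcast interference channel with finite alphabets, whose transition
probability has the form `p(y₁,y₂,y₃|x₁,x₂) = p(y₁|x₁) p(y₂|x₁,x₂) p(y₃|x₂)`. -/
structure BIC (X₁ X₂ Y₁ Y₂ Y₃ : Type*) [Fintype Y₁] [Fintype Y₂] [Fintype Y₃] where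
  W₁ : X₁ → Y₁ → ℝ
  W₂ : X₁ → X₂ → Y₂ → ℝ
  W₃ : X₂ → Y₃ → ℝ
  W₁_mem : ∀ x₁, W₁ x₁ ∈ stdSimplex ℝ Y₁
  W₂_mem : ∀ x₁ x₂, W₂ x₁ x₂ ∈ stdSimplex ℝ Y₂
  W₃_mem : ∀ x₂, W₃ x₂ ∈ stdSimplex ℝ Y₃

/-- A code of blocklength `n` with message sets `{1,…,M_j}` (nonempty), two encoders and three
decoders. -/
structure BICCode (X₁ X₂ Y₁ Y₂ Y₃ : Type*) (n : ℕ) where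
  M₁ : ℕ
  M₂ : ℕ
  M₃ : ℕ
  M₁_pos : 0 < M₁
  M₂_pos : 0 < M₂
  M₃_pos : 0 < M₃
  enc₁ : Fin M₁ × Fin M₂ → (Fin n → X₁)
  enc₂ : Fin M₃ → (Fin n → X₂)
  dec₁ : (Fin n → Y₁) → Fin M₁
  dec₂ : (Fin n → Y₂) → Fin M₂
  dec₃ : (Fin n → Y₃) → Fin M₃

namespace BIC

variable {X₁ X₂ Y₁ Y₂ Y₃ : Type*} [Fintype X₁] [Fintype X₂] [Fintype Y₁] [Fintype Y₂] [Fintype Y₃]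

/-- The transition probability `p(y₁,y₂,y₃|x₁,x₂)`. -/
def trans (ch : BIC X₁ X₂ Y₁ Y₂ Y₃) (x₁ : X₁) (x₂ : X₂) (y₁ : Y₁) (y₂ : Y₂) (y₃ : Y₃) : ℝ :=
  ch.W₁ x₁ y₁ * ch.W₂ x₁ x₂ y₂ * ch.W₃ x₂ y₃

/-- The average probability that some receiver decodes its message wrongly, for independent
uniform messages and `n` memoryless uses of the channel. -/
noncomputable def errorProb (ch : BIC X₁ X₂ Y₁ Y₂ Y₃) {n : ℕ} (c : BICCode X₁ X₂ Y₁ Y₂ Y₃ n) : ℝ :=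
  open Classical in
  (∑ w₁, ∑ w₂, ∑ w₃, ∑ y₁ : Fin n → Y₁, ∑ y₂ : Fin n → Y₂, ∑ y₃ : Fin n → Y₃,
    if c.dec₁ y₁ ≠ w₁ ∨ c.dec₂ y₂ ≠ w₂ ∨ c.dec₃ y₃ ≠ w₃ then
      ∏ i, ch.trans (c.enc₁ (w₁, w₂) i) (c.enc₂ w₃ i) (y₁ i) (y₂ i) (y₃ i)
    else 0) / ((c.M₁ : ℝ) * c.M₂ * c.M₃)

/-- `(R₁,R₂,R₃)` is achievable: there are codes of blocklength `n = 0, 1, 2, …` whose rates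
`log₂ M_j / n` tend to `R_j` and whose error probabilities tend to `0`. -/
def Achievable (ch : BIC X₁ X₂ Y₁ Y₂ Y₃) (R : ℝ × ℝ × ℝ) : Prop :=
  ∃ c : (n : ℕ) → BICCode X₁ X₂ Y₁ Y₂ Y₃ n,
    Tendsto (fun n : ℕ => Real.logb 2 ((c n).M₁ : ℝ) / n) atTop (𝓝 R.1) ∧
    Tendsto (fun n : ℕ => Real.logb 2 ((c n).M₂ : ℝ) / n) atTop (𝓝 R.2.1) ∧
    Tendsto (fun n : ℕ => Real.logb 2 ((c n).M₃ : ℝ) / n) atTop (𝓝 R.2.2) ∧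
    Tendsto (fun n : ℕ => ch.errorProb (c n)) atTop (𝓝 0)

/-- The joint mass function `p(u₁,x₁) p(x₂) p(y₁,y₂,y₃|x₁,x₂)` of `(U₁,X₁,X₂,Y₁,Y₂,Y₃)`. -/
def law (ch : BIC X₁ X₂ Y₁ Y₂ Y₃) {U₁ : Type*} (P : U₁ × X₁ → ℝ) (Q : X₂ → ℝ) :
    U₁ × X₁ × X₂ × Y₁ × Y₂ × Y₃ → ℝ :=
  fun (u₁, x₁, x₂, y₁, y₂, y₃) => P (u₁, x₁) * Q x₂ * ch.trans x₁ x₂ y₁ y₂ y₃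

/-- Receiver 2 is interference-oblivious less noisy than receiver 1: `I(U₁;Y₁) ≤ I(U₁;Y₂)` for
all `p(u₁,x₁) p(x₂)`. (Every finite alphabet of `U₁` is, up to relabelling, some `Fin k`.) -/
def ObliviousLessNoisy (ch : BIC X₁ X₂ Y₁ Y₂ Y₃) : Prop :=
  ∀ (k : ℕ), ∀ P ∈ stdSimplex ℝ (Fin k × X₁), ∀ Q ∈ stdSimplex ℝ X₂,
    mutualInfo (ch.law P Q) (fun (u₁, _, _, _, _, _) => u₁) (fun (_, _, _, y₁, _, _) => y₁) ≤
      mutualInfo (ch.law P Q) (fun (u₁, _, _, _, _, _) => u₁) (fun (_, _, _, _, y₂, _) => y₂)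

/-- The joint mass function `p(u₁,x₁) p(u₂,x₂) p(y₁,y₂,y₃|x₁,x₂)` of
`(U₁,X₁,U₂,X₂,Y₁,Y₂,Y₃)`. -/
def jointLaw (ch : BIC X₁ X₂ Y₁ Y₂ Y₃) {U₁ U₂ : Type*} (P : U₁ × X₁ → ℝ) (Q : U₂ × X₂ → ℝ) :
    U₁ × X₁ × U₂ × X₂ × Y₁ × Y₂ × Y₃ → ℝ :=
  fun (u₁, x₁, u₂, x₂, y₁, y₂, y₃) => P (u₁, x₁) * Q (u₂, x₂) * ch.trans x₁ x₂ y₁ y₂ y₃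

/-- The nonnegative rate triples that satisfy the bounds of superposition coding for the input
law `p(u₁,x₁) p(u₂,x₂)`. -/
def superpositionBounds (ch : BIC X₁ X₂ Y₁ Y₂ Y₃) {U₁ U₂ : Type*} [Fintype U₁] [Fintype U₂]
    (P : U₁ × X₁ → ℝ) (Q : U₂ × X₂ → ℝ) : Set (ℝ × ℝ × ℝ) :=
  let p := ch.jointLaw P Q
  let rvU₁ : U₁ × X₁ × U₂ × X₂ × Y₁ × Y₂ × Y₃ → U₁ := fun (u₁, _, _, _, _, _, _) => u₁
  let rvX₁ : U₁ × X₁ × U₂ × X₂ × Y₁ × Y₂ × Y₃ → X₁ := fun (_, x₁, _, _, _, _, _) => x₁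
  let rvU₂ : U₁ × X₁ × U₂ × X₂ × Y₁ × Y₂ × Y₃ → U₂ := fun (_, _, u₂, _, _, _, _) => u₂
  let rvX₂ : U₁ × X₁ × U₂ × X₂ × Y₁ × Y₂ × Y₃ → X₂ := fun (_, _, _, x₂, _, _, _) => x₂
  let rvY₁ : U₁ × X₁ × U₂ × X₂ × Y₁ × Y₂ × Y₃ → Y₁ := fun (_, _, _, _, y₁, _, _) => y₁
  let rvY₂ : U₁ × X₁ × U₂ × X₂ × Y₁ × Y₂ × Y₃ → Y₂ := fun (_, _, _, _, _, y₂, _) => y₂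
  let rvY₃ : U₁ × X₁ × U₂ × X₂ × Y₁ × Y₂ × Y₃ → Y₃ := fun (_, _, _, _, _, _, y₃) => y₃
  {R | 0 ≤ R.1 ∧ 0 ≤ R.2.1 ∧ 0 ≤ R.2.2 ∧
    R.1 ≤ mutualInfo p rvU₁ rvY₁ ∧
    R.2.1 ≤ condMutualInfo p rvX₁ rvY₂ (fun ω => (rvU₁ ω, rvU₂ ω)) ∧
    R.2.2 ≤ mutualInfo p rvX₂ rvY₃ ∧
    R.2.1 + R.2.2 ≤ condMutualInfo p (fun ω => (rvX₁ ω, rvU₂ ω)) rvY₂ rvU₁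
      + condMutualInfo p rvX₂ rvY₃ rvU₂}

/-- The superposition-only region: the closure of the union of the sets above over all finite
alphabets of `U₁`, `U₂` (up to relabelling, `Fin k` and `Fin l`) and all input laws
`p(u₁) p(x₁|u₁) p(u₂) p(x₂|u₂)`. -/
def superpositionRegion (ch : BIC X₁ X₂ Y₁ Y₂ Y₃) : Set (ℝ × ℝ × ℝ) :=
  closure {R | ∃ (k l : ℕ), ∃ P ∈ stdSimplex ℝ (Fin k × X₁), ∃ Q ∈ stdSimplex ℝ (Fin l × X₂),
    R ∈ ch.superpositionBounds P Q}

end BIC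

/-! ### Laws of random variables and the information density -/

section Law

variable {Ω α β γ τ : Type*} [Fintype Ω]

/-! The proof is random coding with superposition at both transmitters. Transmitter 1 uses clouds
indexed by `W₁` (law of `U₁`) with satellites indexed by `W₂` (law of `X₁` given `U₁`). Transmitter
2 splits its message into a cloud index of rate `Rc` and a satellite index of rate `Rp`, with `Rc +
Rp = R₃`. Receiver 1 decodes its cloud. Receiver 2 decodes `W₂` through the cloud of transmitter 1,
with the cloud of transmitter 2 as a nuisance that need not be recovered uniquely. Receiver 3
decodes both of its indices.

The less noisy hypothesis gives `R₁ ≤ I(U₁;Y₁) ≤ I(U₁;Y₂)`, so receiver 2 can reject every wrong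
cloud of transmitter 1 by comparing that cloud alone with `Y₂`. What remains is `R₂ ≤
I(X₁;Y₂|U₁,U₂)` and `R₂ + Rc ≤ I(X₁,U₂;Y₂|U₁)` at receiver 2, and `Rp ≤ I(X₂;Y₃|U₂)` and `Rc + Rp ≤
I(X₂;Y₃)` at receiver 3. Taking `Rp` as large as `I(X₂;Y₃|U₂)` and `R₃` allow eliminates the split
and leaves the stated sum bound.

Decoding thresholds the likelihood ratio `infoRatio` instead of using typicality. The true codeword
fails a test with exponentially small probability by Chernoff's bound (`exists_sum_prod_lt_le_pow`).
A competitor passes with probability at most `2 ^ (-(n g))` by Markov's inequality, because the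
ratio has mean at most one under the decoupled law (`sum_decoupled_infoRatio_le_one`). The codebook
average (`exists_superposition_codebooks`) is proved for arbitrary finite alphabets and then applied
to blocks of length `n`. -/

theorem sum_lawOf_mul [Fintype α] (p : Ω → ℝ) (A : Ω → α) (f : α → ℝ) :
    ∑ a, lawOf p A a * f a = ∑ ω, p ω * f (A ω) := by
  classical
  simp only [lawOf, Finset.sum_mul, ite_mul, zero_mul]
  rw [Finset.sum_comm]
  refine Finset.sum_congr rfl fun ω _ => ?_
  rw [Finset.sum_eq_single (A ω)]
  · simp
  · intro b _ hb; rw [if_neg hb.symm]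
  · simp

theorem lawOf_eq_sum (p : Ω → ℝ) (A : Ω → α) (a : α) [DecidableEq α] :
    lawOf p A a = ∑ ω, p ω * (if A ω = a then 1 else 0) := by
  classical
  unfold lawOf
  refine Finset.sum_congr rfl fun ω _ => ?_
  by_cases h : A ω = a <;> simp [h]

theorem lawOf_congr (p : Ω → ℝ) {A : Ω → α} {B : Ω → β} {a : α} {b : β}
    (h : ∀ ω, A ω = a ↔ B ω = b) : lawOf p A a = lawOf p B b := by
  classical
  rw [lawOf_eq_sum, lawOf_eq_sum]
  exact Finset.sum_congr rfl fun ω _ => by simp only [h]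

theorem lawOf_nonneg {p : Ω → ℝ} (hp : ∀ ω, 0 ≤ p ω) (A : Ω → α) (a : α) : 0 ≤ lawOf p A a := by
  classical
  unfold lawOf
  exact Finset.sum_nonneg fun ω _ => by split_ifs; exacts [hp ω, le_rfl]

theorem lawOf_pos {p : Ω → ℝ} (hp : ∀ ω, 0 ≤ p ω) (A : Ω → α) {ω : Ω} (h : 0 < p ω) :
    0 < lawOf p A (A ω) := by
  classical
  unfold lawOf
  refine Finset.sum_pos' (fun ω _ => ?_) ⟨ω, Finset.mem_univ _, by simpa using h⟩
  split_ifs; exacts [hp ω, le_rfl]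

theorem lawOf_pair_le {p : Ω → ℝ} (hp : ∀ ω, 0 ≤ p ω) (B : Ω → β) (C : Ω → γ) (b : β) (c : γ) :
    lawOf p (fun ω => (B ω, C ω)) (b, c) ≤ lawOf p C c := by
  classical
  unfold lawOf
  refine Finset.sum_le_sum fun ω _ => ?_
  by_cases h : (B ω, C ω) = (b, c)
  · rw [if_pos h, if_pos (Prod.ext_iff.1 h).2]
  · rw [if_neg h]; split_ifs; exacts [hp ω, le_rfl]

/-- The likelihood ratio `p(a,b,c) p(c) / (p(a,c) p(b,c))`, whose logarithm is the conditional
information density. -/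
noncomputable def infoRatio (p : Ω → ℝ) (A : Ω → α) (B : Ω → β) (C : Ω → γ)
    (a : α) (b : β) (c : γ) : ℝ :=
  lawOf p (fun ω => (A ω, B ω, C ω)) (a, b, c) * lawOf p C c /
    (lawOf p (fun ω => (A ω, C ω)) (a, c) * lawOf p (fun ω => (B ω, C ω)) (b, c))

theorem infoRatio_nonneg {p : Ω → ℝ} (hp : ∀ ω, 0 ≤ p ω) (A : Ω → α) (B : Ω → β) (C : Ω → γ)
    (a : α) (b : β) (c : γ) : 0 ≤ infoRatio p A B C a b c :=
  div_nonneg (mul_nonneg (lawOf_nonneg hp _ _) (lawOf_nonneg hp _ _))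
    (mul_nonneg (lawOf_nonneg hp _ _) (lawOf_nonneg hp _ _))

theorem infoRatio_pos {p : Ω → ℝ} (hp : ∀ ω, 0 ≤ p ω) (A : Ω → α) (B : Ω → β) (C : Ω → γ)
    {ω : Ω} (h : 0 < p ω) : 0 < infoRatio p A B C (A ω) (B ω) (C ω) :=
  div_pos (mul_pos (lawOf_pos hp (fun ω => (A ω, B ω, C ω)) h) (lawOf_pos hp _ h))
    (mul_pos (lawOf_pos hp (fun ω => (A ω, C ω)) h) (lawOf_pos hp (fun ω => (B ω, C ω)) h))

theorem condMutualInfo_eq_sum [Fintype α] [Fintype β] [Fintype γ] (p : Ω → ℝ)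
    (A : Ω → α) (B : Ω → β) (C : Ω → γ) :
    condMutualInfo p A B C = ∑ ω, p ω * Real.logb 2 (infoRatio p A B C (A ω) (B ω) (C ω)) := by
  rw [← sum_lawOf_mul p (fun ω => (A ω, B ω, C ω))
    (fun t => Real.logb 2 (infoRatio p A B C t.1 t.2.1 t.2.2))]
  simp only [Fintype.sum_prod_type]
  rfl

/-- Conditioning on a constant lets one conditional density test serve all six decoding conditions.
-/
theorem mutualInfo_eq_condMutualInfo [Fintype α] [Fintype β] {p : Ω → ℝ} (hp : ∑ ω, p ω = 1)
    (A : Ω → α) (B : Ω → β) :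
    mutualInfo p A B = condMutualInfo p A B (fun _ => ()) := by
  have h1 : lawOf p (fun _ => ()) () = 1 := by simpa [lawOf] using hp
  have h2 : ∀ a b, lawOf p (fun ω => (A ω, B ω, ())) (a, b, ()) =
      lawOf p (fun ω => (A ω, B ω)) (a, b) := fun a b =>
    lawOf_congr p fun ω => by simp
  have h3 : ∀ a, lawOf p (fun ω => (A ω, ())) (a, ()) = lawOf p A a := fun a =>
    lawOf_congr p fun ω => by simp
  have h4 : ∀ b, lawOf p (fun ω => (B ω, ())) (b, ()) = lawOf p B b := fun b =>
    lawOf_congr p fun ω => by simp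
  simp [mutualInfo, condMutualInfo, h1, h2, h3, h4]

theorem lawOf_comp {Ω' : Type*} [Fintype Ω'] (p : Ω → ℝ) (π : Ω → Ω') (A : Ω' → α) (a : α) :
    lawOf (lawOf p π) A a = lawOf p (fun ω => A (π ω)) a := by
  classical
  rw [lawOf_eq_sum, sum_lawOf_mul p π (fun ω' => if A ω' = a then (1 : ℝ) else 0), lawOf_eq_sum]

theorem mutualInfo_lawOf {Ω' : Type*} [Fintype Ω'] [Fintype α] [Fintype β] (p : Ω → ℝ)
    (π : Ω → Ω') (A : Ω' → α) (B : Ω' → β) :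
    mutualInfo (lawOf p π) A B = mutualInfo p (fun ω => A (π ω)) (fun ω => B (π ω)) := by
  simp only [mutualInfo, lawOf_comp]

/-- If `κ` is a version of the conditional law of `A` given `C` (lifted along `φ`), then the
expectation of the likelihood ratio under the decoupled law is at most one. -/
theorem sum_decoupled_infoRatio_le_one [Fintype α] [Fintype β] [Fintype γ] [Fintype τ]
    {p : Ω → ℝ} (hp : ∀ ω, 0 ≤ p ω) (hp1 : ∑ ω, p ω = 1)
    (A : Ω → α) (B : Ω → β) (C : Ω → γ) (κ : γ → τ → ℝ) (φ : τ → α)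
    (hκ : ∀ g : α → γ → ℝ,
      ∑ ω, p ω * g (A ω) (C ω) = ∑ ω, p ω * ∑ t, κ (C ω) t * g (φ t) (C ω)) :
    ∑ ω, p ω * ∑ t, κ (C ω) t * infoRatio p A B C (φ t) (B ω) (C ω) ≤ 1 := by
  classical
  -- Testing `hκ` on indicators of points identifies the image of `κ c` under `φ` with the
  -- conditional law of `A`, wherever `C = c` has positive mass.
  have hAC : ∀ a c, lawOf p (fun ω => (A ω, C ω)) (a, c) =
      lawOf p C c * ∑ t, κ c t * (if φ t = a then 1 else 0) := by
    intro a c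
    have h := hκ (fun a' c' => (if a' = a then 1 else 0) * (if c' = c then 1 else 0))
    rw [lawOf_eq_sum, lawOf_eq_sum, Finset.sum_mul]
    calc _ = _ := Finset.sum_congr rfl fun ω _ => by
            by_cases h1 : A ω = a <;> by_cases h2 : C ω = c <;> simp [h1, h2]
      _ = _ := h
      _ = _ := Finset.sum_congr rfl fun ω _ => by
            by_cases h2 : C ω = c <;> simp [h2]
  have hpush : ∀ b c, ∑ t, κ c t * infoRatio p A B C (φ t) b c =
      ∑ a, (∑ t, κ c t * (if φ t = a then 1 else 0)) * infoRatio p A B C a b c := by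
    intro b c
    simp only [Finset.sum_mul]
    rw [Finset.sum_comm]
    refine Finset.sum_congr rfl fun t _ => ?_
    simp [mul_ite, ite_mul]
  simp only [hpush]
  rw [← sum_lawOf_mul p (fun ω => (B ω, C ω)) (fun s => ∑ a,
    (∑ t, κ s.2 t * (if φ t = a then 1 else 0)) * infoRatio p A B C a s.1 s.2)]
  calc _ ≤ ∑ s : β × γ, ∑ a, lawOf p (fun ω => (A ω, B ω, C ω)) (a, s.1, s.2) := by
        refine Finset.sum_le_sum fun s _ => ?_
        obtain ⟨b, c⟩ := s
        rw [Finset.mul_sum]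
        refine Finset.sum_le_sum fun a _ => ?_
        dsimp only
        -- Where all marginals are positive the decoupled mass times the ratio is exactly
        -- `p(a,b,c)`. Where one vanishes the left side is zero, which is why only an inequality is
        -- claimed.
        rcases eq_or_ne (lawOf p C c) 0 with h0 | h0
        · have : lawOf p (fun ω => (B ω, C ω)) (b, c) = 0 :=
            le_antisymm (h0 ▸ lawOf_pair_le hp B C b c) (lawOf_nonneg hp _ _)
          rw [this, zero_mul]
          exact lawOf_nonneg hp _ _
        · have hk : (∑ t, κ c t * (if φ t = a then 1 else 0)) =
              lawOf p (fun ω => (A ω, C ω)) (a, c) / lawOf p C c := by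
            rw [hAC]; field_simp
          rw [hk]
          unfold infoRatio
          rcases eq_or_ne (lawOf p (fun ω => (A ω, C ω)) (a, c)) 0 with h1 | h1
          · rw [h1]; simpa using lawOf_nonneg hp _ _
          rcases eq_or_ne (lawOf p (fun ω => (B ω, C ω)) (b, c)) 0 with h2 | h2
          · rw [h2]; simpa using lawOf_nonneg hp _ _
          apply le_of_eq
          field_simp
    _ = ∑ t : α × β × γ, lawOf p (fun ω => (A ω, B ω, C ω)) t * 1 := by
        rw [Fintype.sum_prod_type (f := fun t : α × β × γ => _), Finset.sum_comm]
        simp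
    _ = 1 := by rw [sum_lawOf_mul p _ (fun _ => (1 : ℝ))]; simpa using hp1
    _ ≤ 1 := le_rfl

end Law

/-! ### Product laws -/

section ProductLaw

variable {α β γ Ω τ : Type*} [Fintype α] [Fintype β]

theorem sum_pi_prod {n : ℕ} (F : (Fin n → α × β) → ℝ) :
    ∑ h, F h = ∑ f : Fin n → α, ∑ g : Fin n → β, F (fun i => (f i, g i)) := by
  rw [← Fintype.sum_prod_type' (f := fun (f : Fin n → α) (g : Fin n → β) => F (fun i => (f i, g i)))]
  exact Fintype.sum_equiv (Equiv.arrowProdEquivProdArrow (Fin n) (fun _ => α) (fun _ => β)) _ _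
    fun h => rfl

/-- Chernoff's bound for the lower tail of a product of independent positive factors. -/
theorem exists_sum_prod_lt_le_pow [Fintype Ω] {p r : Ω → ℝ} (hp : ∀ ω, 0 ≤ p ω)
    (hp1 : ∑ ω, p ω = 1) (hr : ∀ ω, 0 < p ω → 0 < r ω) {g : ℝ}
    (hg : g < ∑ ω, p ω * Real.logb 2 (r ω)) :
    ∃ c : ℝ, 0 ≤ c ∧ c < 1 ∧ ∀ n : ℕ,
      ∑ t : Fin n → Ω, (∏ i, p (t i)) * (if (2 : ℝ) ^ (n * g) ≤ ∏ i, r (t i) then 0 else 1)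
        ≤ c ^ n := by
  set d : Ω → ℝ := fun ω => Real.log (r ω) - g * Real.log 2 with hd
  set f : ℝ → ℝ := fun s => ∑ ω, p ω * Real.exp (-s * d ω) with hf
  have hl2 : 0 < Real.log 2 := Real.log_pos one_lt_two
  have hmean : 0 < ∑ ω, p ω * d ω := by
    have h1 : ∑ ω, p ω * d ω =
        (∑ ω, p ω * Real.logb 2 (r ω) - g) * Real.log 2 := by
      simp only [hd, mul_sub, Finset.sum_sub_distrib, sub_mul, ← Finset.sum_mul, hp1, one_mul]
      rw [Finset.sum_mul]
      congr 1
      refine Finset.sum_congr rfl fun ω _ => ?_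
      rw [Real.logb, mul_assoc, div_mul_cancel₀ _ hl2.ne']
    rw [h1]
    exact mul_pos (by linarith) hl2
  have hder : HasDerivAt f (∑ ω, p ω * (-d ω)) 0 := by
    refine HasDerivAt.fun_sum fun ω _ => HasDerivAt.const_mul _ ?_
    have h := (((hasDerivAt_id (0 : ℝ)).neg).mul_const (d ω)).exp
    simpa using h
  have hf0 : f 0 = 1 := by simp [hf, hp1]
  -- `f` is the moment generating function of `-d`: it equals 1 at 0 with slope `-E d < 0`, so it
  -- drops below 1 for some small `s > 0`.
  obtain ⟨s, hs, hfs⟩ : ∃ s, 0 < s ∧ f s < 1 := by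
    have h := hasDerivAt_iff_tendsto_slope.1 hder
    have hneg : ∑ ω, p ω * (-d ω) < 0 := by simpa using hmean
    have h' := (h.eventually_lt_const hneg).filter_mono
      (nhdsWithin_mono (0 : ℝ) (fun x (hx : x ∈ Set.Ioi (0 : ℝ)) => (ne_of_gt hx : x ≠ 0)))
    obtain ⟨s, hs1, hs2⟩ := (h'.and self_mem_nhdsWithin).exists
    refine ⟨s, hs2, ?_⟩
    rw [slope_def_field, hf0, sub_zero] at hs1
    by_contra hcon
    push Not at hcon
    exact absurd hs1 (not_lt.2 (div_nonneg (by linarith) (le_of_lt hs2)))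
  refine ⟨f s, Finset.sum_nonneg fun ω _ => mul_nonneg (hp ω) (Real.exp_pos _).le, hfs, fun n => ?_⟩
  rw [hf, Fintype.sum_pow]
  refine Finset.sum_le_sum fun t _ => ?_
  rw [Finset.prod_mul_distrib]
  -- Positivity of `r` is known only on the support of `p`, so blocks of mass zero are set aside
  -- before taking logarithms.
  by_cases h0 : ∃ i, p (t i) = 0
  · obtain ⟨i, hi⟩ := h0
    rw [Finset.prod_eq_zero (Finset.mem_univ i) hi]; simp
  push Not at h0
  refine mul_le_mul_of_nonneg_left ?_ (Finset.prod_nonneg fun i _ => hp _)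
  have hri : ∀ i, 0 < r (t i) := fun i => hr _ (lt_of_le_of_ne (hp _) (h0 i).symm)
  split_ifs with hc
  · exact Finset.prod_nonneg fun i _ => (Real.exp_pos _).le
  rw [← Real.exp_sum, Real.one_le_exp_iff, ← Finset.mul_sum]
  simp only [hd, Finset.sum_sub_distrib]
  rw [← Real.log_prod (fun i _ => (hri i).ne')]
  have hlt := Real.log_lt_log (Finset.prod_pos fun i _ => hri i) (not_le.1 hc)
  rw [Real.log_rpow two_pos] at hlt
  simp only [Finset.sum_const, Finset.card_univ, Fintype.card_fin, nsmul_eq_mul]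
  nlinarith

/-- Markov's inequality for a product of independent factors of mean at most one. -/
theorem sum_prod_ge_le {n : ℕ} {q r : α → ℝ} (hq : ∀ t, 0 ≤ q t) (hr : ∀ t, 0 ≤ r t)
    (h1 : ∑ t, q t * r t ≤ 1) (g : ℝ) :
    ∑ t : Fin n → α, (∏ i, q (t i)) * (if (2 : ℝ) ^ (n * g) ≤ ∏ i, r (t i) then 1 else 0)
      ≤ 2 ^ (-(n * g)) := by
  have hpow : (∑ t, q t * r t) ^ n ≤ 1 :=
    pow_le_one₀ (Finset.sum_nonneg fun t _ => mul_nonneg (hq t) (hr t)) h1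
  have h2 : (0 : ℝ) < 2 ^ (-(n * g)) := Real.rpow_pos_of_pos two_pos _
  calc _ ≤ ∑ t : Fin n → α, (∏ i, q (t i) * r (t i)) * 2 ^ (-(n * g)) := by
        refine Finset.sum_le_sum fun t _ => ?_
        rw [Finset.prod_mul_distrib, mul_assoc]
        refine mul_le_mul_of_nonneg_left ?_ (Finset.prod_nonneg fun i _ => hq _)
        split_ifs with hc
        · rw [Real.rpow_neg two_pos.le, ← div_eq_mul_inv,
            one_le_div (Real.rpow_pos_of_pos two_pos _)]
          exact hc
        · exact mul_nonneg (Finset.prod_nonneg fun i _ => hr _) h2.le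
    _ = (∑ t, q t * r t) ^ n * 2 ^ (-(n * g)) := by
        rw [← Finset.sum_mul, Fintype.sum_pow]
    _ ≤ 2 ^ (-(n * g)) := mul_le_of_le_one_left h2.le hpow

/-- The decoupled pair is an i.i.d. block under `p s.1 * κ (C s.1) s.2`, so Markov's inequality for
products applies. The type `τ` may carry more than the tested variable, such as an unused satellite.
-/
theorem sum_decoupled_prod_infoRatio_ge_le {n : ℕ} [Fintype Ω] [Fintype γ] [Fintype τ]
    {p : Ω → ℝ} (hp : ∀ ω, 0 ≤ p ω) (hp1 : ∑ ω, p ω = 1)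
    (A : Ω → α) (B : Ω → β) (C : Ω → γ) (κ : γ → τ → ℝ) (hκ0 : ∀ c t, 0 ≤ κ c t) (φ : τ → α)
    (hκ : ∀ g : α → γ → ℝ,
      ∑ ω, p ω * g (A ω) (C ω) = ∑ ω, p ω * ∑ t, κ (C ω) t * g (φ t) (C ω)) (g : ℝ) :
    ∑ ω : Fin n → Ω, (∏ i, p (ω i)) * ∑ t : Fin n → τ, (∏ i, κ (C (ω i)) (t i)) *
      (if (2 : ℝ) ^ (n * g) ≤ ∏ i, infoRatio p A B C (φ (t i)) (B (ω i)) (C (ω i)) then 1 else 0)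
      ≤ 2 ^ (-(n * g)) := by
  have h := sum_prod_ge_le (n := n) (q := fun s : Ω × τ => p s.1 * κ (C s.1) s.2)
    (r := fun s => infoRatio p A B C (φ s.2) (B s.1) (C s.1))
    (fun s => mul_nonneg (hp _) (hκ0 _ _)) (fun s => infoRatio_nonneg hp _ _ _ _ _ _)
    (by
      rw [Fintype.sum_prod_type]
      have := sum_decoupled_infoRatio_le_one hp hp1 A B C κ φ hκ
      simpa only [Finset.mul_sum, mul_assoc] using this) g
  rw [sum_pi_prod] at h
  simpa only [Finset.prod_mul_distrib, Finset.mul_sum, mul_assoc] using h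

end ProductLaw

/-! ### Random superposition codebooks -/

section RandomCoding

theorem sum_mul_sum_mul_comm {S T : Type*} [Fintype S] [Fintype T] (k : S → ℝ) (q : T → ℝ)
    (g : S → T → ℝ) :
    ∑ s, k s * ∑ t, q t * g s t = ∑ t, q t * ∑ s, k s * g s t := by
  simp only [Finset.mul_sum]
  rw [Finset.sum_comm]
  exact Finset.sum_congr rfl fun _ _ => Finset.sum_congr rfl fun _ _ => mul_left_comm _ _ _

/-- Used when a competing codeword is independent of the channel output given what is tested: its
average can be moved inside the channel average. -/
theorem sum_mul_channel_comm {S X B Z Y : Type*} [Fintype S] [Fintype B] [Fintype Z] [Fintype Y]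
    {QB : B → ℝ} {L : B → Z → ℝ} {T : X → Z → Y → ℝ} (k : S → ℝ) (x : X)
    (g : S → B → Z → Y → ℝ) :
    ∑ s, k s * ∑ b, QB b * ∑ z, L b z * ∑ y, T x z y * g s b z y =
      ∑ b, QB b * ∑ z, L b z * ∑ y, T x z y * ∑ s, k s * g s b z y := by
  rw [sum_mul_sum_mul_comm]
  refine Finset.sum_congr rfl fun b _ => ?_
  rw [sum_mul_sum_mul_comm]
  congr 1
  refine Finset.sum_congr rfl fun z _ => ?_
  rw [sum_mul_sum_mul_comm]

theorem exists_le_weighted_sum {S : Type*} [Fintype S] {μ : S → ℝ} (h0 : ∀ s, 0 ≤ μ s)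
    (h1 : ∑ s, μ s = 1) (f : S → ℝ) : ∃ s, f s ≤ ∑ s, μ s * f s := by
  by_contra! h
  have : ∑ s, μ s * (∑ s, μ s * f s) < ∑ s, μ s * f s := by
    obtain ⟨s, -, hs⟩ : ∃ s ∈ Finset.univ, μ s ≠ 0 :=
      Finset.exists_ne_zero_of_sum_ne_zero (by rw [h1]; exact one_ne_zero)
    refine Finset.sum_lt_sum (fun s _ => mul_le_mul_of_nonneg_left (h s).le (h0 s))
      ⟨s, Finset.mem_univ _, mul_lt_mul_of_pos_left (h s) (lt_of_le_of_ne (h0 s) hs.symm)⟩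
  rw [← Finset.sum_mul, h1, one_mul] at this
  exact lt_irrefl _ this

theorem sum_erase_eq_of_const {S : Type*} [Fintype S] [DecidableEq S] (s : S) (g : S → ℝ) (r : ℝ)
    (h : ∀ s', s ≠ s' → g s' = r) :
    ∑ s' ∈ Finset.univ.erase s, g s' = ((Fintype.card S - 1 : ℕ) : ℝ) * r := by
  rw [Finset.sum_congr rfl fun s' hs' => h s' (Finset.ne_of_mem_erase hs').symm,
    Finset.sum_const, Finset.card_erase_of_mem (Finset.mem_univ _), nsmul_eq_mul]
  rfl

/-! ### Marginals of one and two coordinates of an i.i.d. family -/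

section Iid

variable {ι T : Type*} [Fintype ι] [DecidableEq ι] [Fintype T] {ν : T → ℝ}

theorem sum_iid (h1 : ∑ t, ν t = 1) : ∑ c : ι → T, ∏ j, ν (c j) = 1 := by
  classical
  rw [← Fintype.prod_sum (fun (_ : ι) t => ν t)]
  simp [h1]

theorem sum_iid_apply (h1 : ∑ t, ν t = 1) (i : ι) (f : T → ℝ) :
    ∑ c : ι → T, (∏ j, ν (c j)) * f (c i) = ∑ t, ν t * f t := by
  classical
  have h : ∀ c : ι → T, (∏ j, ν (c j)) * f (c i) =
      ∏ j, ν (c j) * (if j = i then f (c j) else 1) := fun c => by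
    rw [Finset.prod_mul_distrib]; simp
  simp only [h]
  rw [← Fintype.prod_sum (fun (j : ι) t => ν t * (if j = i then f t else 1)),
    Finset.prod_eq_single i]
  · simp
  · intro j _ hj; simp [hj, h1]
  · simp

theorem sum_iid_apply_apply (h1 : ∑ t, ν t = 1) {i j : ι} (hij : i ≠ j) (f : T → T → ℝ) :
    ∑ c : ι → T, (∏ j, ν (c j)) * f (c i) (c j) = ∑ s, ν s * ∑ t, ν t * f s t := by
  classical
  have hmul : ∀ F G : T → ℝ, ∑ c : ι → T, (∏ j, ν (c j)) * (F (c i) * G (c j)) =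
      (∑ t, ν t * F t) * ∑ t, ν t * G t := by
    intro F G
    have h : ∀ c : ι → T, (∏ j, ν (c j)) * (F (c i) * G (c j)) =
        ∏ k, ν (c k) * ((if k = i then F (c k) else 1) * (if k = j then G (c k) else 1)) :=
      fun c => by rw [Finset.prod_mul_distrib, Finset.prod_mul_distrib]; simp
    simp only [h]
    rw [← Fintype.prod_sum (fun (k : ι) t =>
        ν t * ((if k = i then F t else 1) * (if k = j then G t else 1))),
      ← Finset.prod_subset (Finset.subset_univ {i, j}), Finset.prod_pair hij]
    · simp [hij, hij.symm]
    · intro k _ hk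
      simp only [Finset.mem_insert, Finset.mem_singleton, not_or] at hk
      simp [hk.1, hk.2, h1]
  -- Conditioning on the value of `c i` turns `f` into a sum of product functions, for which `hmul`
  -- factorizes.
  have hexp : ∀ c : ι → T, (∏ j, ν (c j)) * f (c i) (c j) =
      ∑ s, (∏ j, ν (c j)) * ((if c i = s then 1 else 0) * f s (c j)) := fun c => by
    rw [← Finset.mul_sum]; simp
  simp only [hexp]
  rw [Finset.sum_comm]
  refine Finset.sum_congr rfl fun s _ => ?_
  rw [hmul (fun t => if t = s then 1 else 0) (f s)]
  simp

end Iid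

/-! ### Joint laws of codewords in a random superposition codebook -/

section Superposition

variable {W V A X : Type*} [Fintype W] [Fintype V]

/-- The law of a random superposition codebook: independent cloud centres with law `PA` and,
given its cloud centre, independent satellites with law `K`. -/
def superLaw (PA : A → ℝ) (K : A → X → ℝ) (c : W → A × (V → X)) : ℝ :=
  ∏ w, (PA (c w).1 * ∏ v, K (c w).1 ((c w).2 v))

variable {PA : A → ℝ} {K : A → X → ℝ}

theorem superLaw_nonneg (hPA : ∀ a, 0 ≤ PA a) (hK : ∀ a x, 0 ≤ K a x) (c : W → A × (V → X)) :
    0 ≤ superLaw PA K c :=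
  Finset.prod_nonneg fun _ _ => mul_nonneg (hPA _) (Finset.prod_nonneg fun _ _ => hK _ _)

variable [DecidableEq W] [DecidableEq V] [Fintype A] [Fintype X]

theorem sum_cloud (hPA1 : ∑ a, PA a = 1) (hK1 : ∀ a, ∑ x, K a x = 1) :
    ∑ t : A × (V → X), PA t.1 * ∏ v, K t.1 (t.2 v) = 1 := by
  rw [Fintype.sum_prod_type]
  simp only [← Finset.mul_sum, sum_iid (hK1 _), mul_one, hPA1]

theorem sum_cloud_apply (hK1 : ∀ a, ∑ x, K a x = 1) (v : V) (f : A → X → ℝ) :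
    ∑ t : A × (V → X), (PA t.1 * ∏ v, K t.1 (t.2 v)) * f t.1 (t.2 v) =
      ∑ a, PA a * ∑ x, K a x * f a x := by
  rw [Fintype.sum_prod_type]
  simp only [mul_assoc, ← Finset.mul_sum]
  exact Finset.sum_congr rfl fun a _ => by rw [sum_iid_apply (hK1 a) v (f a)]

theorem sum_superLaw (hPA1 : ∑ a, PA a = 1) (hK1 : ∀ a, ∑ x, K a x = 1) :
    ∑ c : W → A × (V → X), superLaw PA K c = 1 :=
  sum_iid (ν := fun t : A × (V → X) => PA t.1 * ∏ v, K t.1 (t.2 v)) (sum_cloud hPA1 hK1)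

theorem sum_superLaw_single (hPA1 : ∑ a, PA a = 1) (hK1 : ∀ a, ∑ x, K a x = 1) (w : W) (v : V)
    (f : A → X → ℝ) :
    ∑ c : W → A × (V → X), superLaw PA K c * f (c w).1 ((c w).2 v) =
      ∑ a, PA a * ∑ x, K a x * f a x :=
  (sum_iid_apply (ν := fun t : A × (V → X) => PA t.1 * ∏ v, K t.1 (t.2 v)) (sum_cloud hPA1 hK1) w
    (fun t => f t.1 (t.2 v))).trans (sum_cloud_apply hK1 v f)

/-- Two satellites of one cloud are independent only conditionally on the shared centre. -/
theorem sum_superLaw_same_cloud (hPA1 : ∑ a, PA a = 1) (hK1 : ∀ a, ∑ x, K a x = 1) (w : W)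
    {v v' : V} (hv : v ≠ v') (f : A → X → X → ℝ) :
    ∑ c : W → A × (V → X), superLaw PA K c * f (c w).1 ((c w).2 v) ((c w).2 v') =
      ∑ a, PA a * ∑ x, K a x * ∑ x', K a x' * f a x x' := by
  refine (sum_iid_apply (ν := fun t : A × (V → X) => PA t.1 * ∏ v, K t.1 (t.2 v))
    (sum_cloud hPA1 hK1) w (fun t => f t.1 (t.2 v) (t.2 v'))).trans ?_
  rw [Fintype.sum_prod_type]
  simp only [mul_assoc, ← Finset.mul_sum]
  exact Finset.sum_congr rfl fun a _ => by rw [sum_iid_apply_apply (hK1 a) hv (f a)]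

/-- Different clouds are fully independent, so the competitor has the unconditional law of a centre
and satellite. -/
theorem sum_superLaw_other_cloud (hPA1 : ∑ a, PA a = 1) (hK1 : ∀ a, ∑ x, K a x = 1) {w w' : W}
    (hw : w ≠ w') (v v' : V) (f : A → X → A → X → ℝ) :
    ∑ c : W → A × (V → X),
      superLaw PA K c * f (c w).1 ((c w).2 v) (c w').1 ((c w').2 v') =
      ∑ a, PA a * ∑ x, K a x * ∑ t : A × X, (PA t.1 * K t.1 t.2) * f a x t.1 t.2 := by
  refine (sum_iid_apply_apply (ν := fun t : A × (V → X) => PA t.1 * ∏ v, K t.1 (t.2 v))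
    (sum_cloud hPA1 hK1) hw (fun s t => f s.1 (s.2 v) t.1 (t.2 v'))).trans ?_
  have h : ∀ s : A × (V → X), ∑ t : A × (V → X), (PA t.1 * ∏ v, K t.1 (t.2 v)) *
      f s.1 (s.2 v) t.1 (t.2 v') =
      ∑ t : A × X, (PA t.1 * K t.1 t.2) * f s.1 (s.2 v) t.1 t.2 := fun s => by
    rw [sum_cloud_apply hK1 v' (f s.1 (s.2 v)), Fintype.sum_prod_type]
    simp only [mul_assoc, Finset.mul_sum]
  simp only [h]
  exact sum_cloud_apply hK1 v (fun a x => ∑ t : A × X, (PA t.1 * K t.1 t.2) * f a x t.1 t.2)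

end Superposition

/-! ### Codebook averages for each type of decoding error -/

section TwoTransmitters

variable {W₁ W₂ Wc Wp A X B Z Y : Type*}
  [Fintype W₁] [DecidableEq W₁] [Fintype W₂] [DecidableEq W₂]
  [Fintype Wc] [DecidableEq Wc] [Fintype Wp] [DecidableEq Wp]
  [Fintype A] [Fintype X] [Fintype B] [Fintype Z] [Fintype Y]

/-- Expectation under `p(a) p(x|a) p(b) p(z|b) p(y|x,z)`. -/
def channelMean (PA : A → ℝ) (K : A → X → ℝ) (QB : B → ℝ) (L : B → Z → ℝ) (T : X → Z → Y → ℝ)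
    (f : A → X → B → Z → Y → ℝ) : ℝ :=
  ∑ a, PA a * ∑ x, K a x * ∑ b, QB b * ∑ z, L b z * ∑ y, T x z y * f a x b z y

/-- Expectation over two independent superposition codebooks and the channel output, when the
messages `w₁, w₂, wc, wp` are sent. -/
def codebookMean (PA : A → ℝ) (K : A → X → ℝ) (QB : B → ℝ) (L : B → Z → ℝ) (T : X → Z → Y → ℝ)
    (w₁ : W₁) (w₂ : W₂) (wc : Wc) (wp : Wp)
    (f : (W₁ → A × (W₂ → X)) → (Wc → B × (Wp → Z)) → Y → ℝ) : ℝ :=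
  ∑ c, superLaw PA K c * ∑ d, superLaw QB L d *
    ∑ y, T ((c w₁).2 w₂) ((d wc).2 wp) y * f c d y

variable {PA : A → ℝ} {K : A → X → ℝ} {QB : B → ℝ} {L : B → Z → ℝ} {T : X → Z → Y → ℝ}

theorem codebookMean_add (w₁ : W₁) (w₂ : W₂) (wc : Wc) (wp : Wp)
    (f g : (W₁ → A × (W₂ → X)) → (Wc → B × (Wp → Z)) → Y → ℝ) :
    codebookMean PA K QB L T w₁ w₂ wc wp (fun c d y => f c d y + g c d y) =
      codebookMean PA K QB L T w₁ w₂ wc wp f + codebookMean PA K QB L T w₁ w₂ wc wp g := by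
  simp only [codebookMean, mul_add, Finset.sum_add_distrib]

theorem codebookMean_sum {S : Type*} (s : Finset S) (w₁ : W₁) (w₂ : W₂) (wc : Wc) (wp : Wp)
    (f : S → (W₁ → A × (W₂ → X)) → (Wc → B × (Wp → Z)) → Y → ℝ) :
    codebookMean PA K QB L T w₁ w₂ wc wp (fun c d y => ∑ i ∈ s, f i c d y) =
      ∑ i ∈ s, codebookMean PA K QB L T w₁ w₂ wc wp (f i) := by
  classical
  induction s using Finset.induction_on with
  | empty => simp [codebookMean]
  | insert i s hi ih =>
    simp only [Finset.sum_insert hi]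
    rw [codebookMean_add, ih]

variable (hPA1 : ∑ a, PA a = 1) (hK1 : ∀ a, ∑ x, K a x = 1)
  (hQB1 : ∑ b, QB b = 1) (hL1 : ∀ b, ∑ z, L b z = 1)

include hPA1 hK1 hQB1 hL1

theorem codebookMean_true (w₁ : W₁) (w₂ : W₂) (wc : Wc) (wp : Wp) (F : A → X → B → Z → Y → ℝ) :
    codebookMean PA K QB L T w₁ w₂ wc wp (fun c d y =>
      F (c w₁).1 ((c w₁).2 w₂) (d wc).1 ((d wc).2 wp) y) = channelMean PA K QB L T F := by
  unfold codebookMean channelMean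
  rw [sum_superLaw_single hPA1 hK1 w₁ w₂ (fun a x => ∑ d, superLaw QB L d *
    ∑ y, T x ((d wc).2 wp) y * F a x (d wc).1 ((d wc).2 wp) y)]
  refine Finset.sum_congr rfl fun a _ => ?_
  congr 1
  refine Finset.sum_congr rfl fun x _ => ?_
  rw [sum_superLaw_single hQB1 hL1 wc wp (fun b z => ∑ y, T x z y * F a x b z y)]

/-- A wrong centre is independent of the output. Its satellite plays no role in `G`; the index `w₂`
merely fills that slot. -/
theorem codebookMean_other_cloud {w₁ w₁' : W₁} (hw : w₁ ≠ w₁') (w₂ : W₂) (wc : Wc) (wp : Wp)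
    (G : A → Y → ℝ) :
    codebookMean PA K QB L T w₁ w₂ wc wp (fun c _ y => G (c w₁').1 y) =
      channelMean PA K QB L T (fun _ _ _ _ y => ∑ t : A × X, (PA t.1 * K t.1 t.2) * G t.1 y) := by
  unfold codebookMean channelMean
  rw [sum_superLaw_other_cloud hPA1 hK1 hw w₂ w₂ (fun _ x a' _ => ∑ d, superLaw QB L d *
    ∑ y, T x ((d wc).2 wp) y * G a' y)]
  refine Finset.sum_congr rfl fun a _ => ?_
  congr 1
  refine Finset.sum_congr rfl fun x _ => ?_
  congr 1
  rw [← sum_mul_channel_comm (fun t : A × X => PA t.1 * K t.1 t.2) x (fun t _ _ y => G t.1 y)]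
  refine Finset.sum_congr rfl fun t _ => ?_
  rw [sum_superLaw_single hQB1 hL1 wc wp (fun b z => ∑ y, T x z y * G t.1 y)]

theorem codebookMean_same_cloud (w₁ : W₁) {w₂ w₂' : W₂} (hw : w₂ ≠ w₂') (wc : Wc) (wp : Wp)
    (G : A → X → B → Y → ℝ) :
    codebookMean PA K QB L T w₁ w₂ wc wp (fun c d y =>
      G (c w₁).1 ((c w₁).2 w₂') (d wc).1 y) =
      channelMean PA K QB L T (fun a _ b _ y => ∑ x', K a x' * G a x' b y) := by
  unfold codebookMean channelMean
  rw [sum_superLaw_same_cloud hPA1 hK1 w₁ hw (fun a x x' => ∑ d, superLaw QB L d *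
    ∑ y, T x ((d wc).2 wp) y * G a x' (d wc).1 y)]
  refine Finset.sum_congr rfl fun a _ => ?_
  congr 1
  refine Finset.sum_congr rfl fun x _ => ?_
  congr 1
  rw [← sum_mul_channel_comm (K a) x (fun x' b _ y => G a x' b y)]
  refine Finset.sum_congr rfl fun x' _ => ?_
  rw [sum_superLaw_single hQB1 hL1 wc wp (fun b z => ∑ y, T x z y * G a x' b y)]

/-- Given the true centre of transmitter 1, the wrong satellite and the wrong centre of transmitter
2 are independent of each other and of the output. This event produces the bound on `R₂ + Rc`. -/
theorem codebookMean_same_cloud_other_cloud (w₁ : W₁) {w₂ w₂' : W₂} (hw : w₂ ≠ w₂')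
    {wc wc' : Wc} (hc : wc ≠ wc') (wp : Wp) (G : A → X → B → Y → ℝ) :
    codebookMean PA K QB L T w₁ w₂ wc wp (fun c d y =>
      G (c w₁).1 ((c w₁).2 w₂') (d wc').1 y) =
      channelMean PA K QB L T (fun a _ _ _ y => ∑ x', K a x' *
        ∑ t : B × Z, (QB t.1 * L t.1 t.2) * G a x' t.1 y) := by
  unfold codebookMean channelMean
  rw [sum_superLaw_same_cloud hPA1 hK1 w₁ hw (fun a x x' => ∑ d, superLaw QB L d *
    ∑ y, T x ((d wc).2 wp) y * G a x' (d wc').1 y)]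
  refine Finset.sum_congr rfl fun a _ => ?_
  congr 1
  refine Finset.sum_congr rfl fun x _ => ?_
  congr 1
  rw [← sum_mul_channel_comm (K a) x
    (fun x' _ _ y => ∑ t : B × Z, (QB t.1 * L t.1 t.2) * G a x' t.1 y)]
  refine Finset.sum_congr rfl fun x' _ => ?_
  rw [sum_superLaw_other_cloud hQB1 hL1 hc wp wp
    (fun b z b' _ => ∑ y, T x z y * G a x' b' y)]
  simp only [sum_mul_sum_mul_comm (fun t : B × Z => QB t.1 * L t.1 t.2)]

theorem codebookMean_second_same_cloud (w₁ : W₁) (w₂ : W₂) (wc : Wc) {wp wp' : Wp}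
    (hp : wp ≠ wp') (G : B → Z → Y → ℝ) :
    codebookMean PA K QB L T w₁ w₂ wc wp (fun _ d y => G (d wc).1 ((d wc).2 wp') y) =
      channelMean PA K QB L T (fun _ _ b _ y => ∑ z', L b z' * G b z' y) := by
  unfold codebookMean channelMean
  rw [sum_superLaw_single hPA1 hK1 w₁ w₂ (fun _ x => ∑ d, superLaw QB L d *
    ∑ y, T x ((d wc).2 wp) y * G (d wc).1 ((d wc).2 wp') y)]
  refine Finset.sum_congr rfl fun a _ => ?_
  congr 1
  refine Finset.sum_congr rfl fun x _ => ?_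
  rw [sum_superLaw_same_cloud hQB1 hL1 wc hp (fun b z z' => ∑ y, T x z y * G b z' y)]
  simp only [sum_mul_sum_mul_comm (T := Y)]

theorem codebookMean_second_other_cloud (w₁ : W₁) (w₂ : W₂) {wc wc' : Wc} (hc : wc ≠ wc')
    (wp wp' : Wp) (G : Z → Y → ℝ) :
    codebookMean PA K QB L T w₁ w₂ wc wp (fun _ d y => G ((d wc').2 wp') y) =
      channelMean PA K QB L T (fun _ _ _ _ y =>
        ∑ t : B × Z, (QB t.1 * L t.1 t.2) * G t.2 y) := by
  unfold codebookMean channelMean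
  rw [sum_superLaw_single hPA1 hK1 w₁ w₂ (fun _ x => ∑ d, superLaw QB L d *
    ∑ y, T x ((d wc).2 wp) y * G ((d wc').2 wp') y)]
  refine Finset.sum_congr rfl fun a _ => ?_
  congr 1
  refine Finset.sum_congr rfl fun x _ => ?_
  rw [sum_superLaw_other_cloud hQB1 hL1 hc wp wp' (fun b z _ z' => ∑ y, T x z y * G z' y)]
  simp only [sum_mul_sum_mul_comm (fun t : B × Z => QB t.1 * L t.1 t.2)]

/-- Some pair of superposition codebooks is at least as good as the average one. -/
theorem exists_superposition_codebooks (hPA0 : ∀ a, 0 ≤ PA a) (hK0 : ∀ a x, 0 ≤ K a x)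
    (hQB0 : ∀ b, 0 ≤ QB b) (hL0 : ∀ b z, 0 ≤ L b z)
    (F : A → X → B → Z → Y → ℝ) (G₁ : A → Y → ℝ) (G₂ G₃ : A → X → B → Y → ℝ)
    (G₄ : B → Z → Y → ℝ) (G₅ : Z → Y → ℝ) :
    ∃ (c : W₁ → A × (W₂ → X)) (d : Wc → B × (Wp → Z)),
      ∑ w : W₁ × W₂ × Wc × Wp,
        ∑ y, T ((c w.1).2 w.2.1) ((d w.2.2.1).2 w.2.2.2) y *
          (F (c w.1).1 ((c w.1).2 w.2.1) (d w.2.2.1).1 ((d w.2.2.1).2 w.2.2.2) y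
          + ∑ w₁' ∈ Finset.univ.erase w.1, G₁ (c w₁').1 y
          + ∑ w₂' ∈ Finset.univ.erase w.2.1, G₂ (c w.1).1 ((c w.1).2 w₂') (d w.2.2.1).1 y
          + ∑ w₂' ∈ Finset.univ.erase w.2.1, ∑ wc' ∈ Finset.univ.erase w.2.2.1,
              G₃ (c w.1).1 ((c w.1).2 w₂') (d wc').1 y
          + ∑ wp' ∈ Finset.univ.erase w.2.2.2, G₄ (d w.2.2.1).1 ((d w.2.2.1).2 wp') y
          + ∑ wc' ∈ Finset.univ.erase w.2.2.1, ∑ wp', G₅ ((d wc').2 wp') y) ≤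
      Fintype.card (W₁ × W₂ × Wc × Wp) *
        (channelMean PA K QB L T F
        + ((Fintype.card W₁ - 1 : ℕ) : ℝ) * channelMean PA K QB L T
            (fun _ _ _ _ y => ∑ t : A × X, (PA t.1 * K t.1 t.2) * G₁ t.1 y)
        + ((Fintype.card W₂ - 1 : ℕ) : ℝ) * channelMean PA K QB L T
            (fun a _ b _ y => ∑ x', K a x' * G₂ a x' b y)
        + ((Fintype.card W₂ - 1 : ℕ) : ℝ) * (((Fintype.card Wc - 1 : ℕ) : ℝ) *
            channelMean PA K QB L T (fun a _ _ _ y => ∑ x', K a x' *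
              ∑ t : B × Z, (QB t.1 * L t.1 t.2) * G₃ a x' t.1 y))
        + ((Fintype.card Wp - 1 : ℕ) : ℝ) * channelMean PA K QB L T
            (fun _ _ b _ y => ∑ z', L b z' * G₄ b z' y)
        + ((Fintype.card Wc - 1 : ℕ) : ℝ) * (Fintype.card Wp * channelMean PA K QB L T
            (fun _ _ _ _ y => ∑ t : B × Z, (QB t.1 * L t.1 t.2) * G₅ t.2 y))) := by
  set H : (w : W₁ × W₂ × Wc × Wp) → (W₁ → A × (W₂ → X)) → (Wc → B × (Wp → Z)) → Y → ℝ :=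
    fun w c d y => F (c w.1).1 ((c w.1).2 w.2.1) (d w.2.2.1).1 ((d w.2.2.1).2 w.2.2.2) y
          + ∑ w₁' ∈ Finset.univ.erase w.1, G₁ (c w₁').1 y
          + ∑ w₂' ∈ Finset.univ.erase w.2.1, G₂ (c w.1).1 ((c w.1).2 w₂') (d w.2.2.1).1 y
          + ∑ w₂' ∈ Finset.univ.erase w.2.1, ∑ wc' ∈ Finset.univ.erase w.2.2.1,
              G₃ (c w.1).1 ((c w.1).2 w₂') (d wc').1 y
          + ∑ wp' ∈ Finset.univ.erase w.2.2.2, G₄ (d w.2.2.1).1 ((d w.2.2.1).2 wp') y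
          + ∑ wc' ∈ Finset.univ.erase w.2.2.1, ∑ wp', G₅ ((d wc').2 wp') y with hH
  -- The total over all messages is averaged, so one pair of codebooks serves all message tuples at
  -- once: first `c`, then `d` for that `c`.
  obtain ⟨c, hc⟩ := exists_le_weighted_sum (superLaw_nonneg (W := W₁) (V := W₂) hPA0 hK0)
    (sum_superLaw hPA1 hK1) (fun c => ∑ d : Wc → B × (Wp → Z), superLaw QB L d *
      ∑ w : W₁ × W₂ × Wc × Wp,
        ∑ y, T ((c w.1).2 w.2.1) ((d w.2.2.1).2 w.2.2.2) y * H w c d y)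
  obtain ⟨d, hd⟩ := exists_le_weighted_sum (superLaw_nonneg (W := Wc) (V := Wp) hQB0 hL0)
    (sum_superLaw hQB1 hL1) (fun d => ∑ w : W₁ × W₂ × Wc × Wp,
        ∑ y, T ((c w.1).2 w.2.1) ((d w.2.2.1).2 w.2.2.2) y * H w c d y)
  refine ⟨c, d, (hd.trans hc).trans (le_of_eq ?_)⟩
  have hswap : ∑ c : W₁ → A × (W₂ → X), superLaw PA K c * ∑ d : Wc → B × (Wp → Z),
      superLaw QB L d * ∑ w : W₁ × W₂ × Wc × Wp,
        ∑ y, T ((c w.1).2 w.2.1) ((d w.2.2.1).2 w.2.2.2) y * H w c d y =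
      ∑ w : W₁ × W₂ × Wc × Wp, codebookMean PA K QB L T w.1 w.2.1 w.2.2.1 w.2.2.2 (H w) := by
    unfold codebookMean
    rw [Finset.sum_comm]
    refine Finset.sum_congr rfl fun c _ => ?_
    rw [← Finset.mul_sum]
    congr 1
    rw [Finset.sum_comm]
    exact Finset.sum_congr rfl fun d _ => Finset.mul_sum _ _ _
  rw [hswap, Fintype.card, ← nsmul_eq_mul, ← Finset.sum_const]
  refine Finset.sum_congr rfl fun w _ => ?_
  obtain ⟨w₁, w₂, wc, wp⟩ := w
  simp only [hH, codebookMean_add, codebookMean_sum]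
  rw [codebookMean_true hPA1 hK1 hQB1 hL1,
    sum_erase_eq_of_const w₁ _ _ fun w₁' h =>
      codebookMean_other_cloud hPA1 hK1 hQB1 hL1 h w₂ wc wp G₁,
    sum_erase_eq_of_const w₂ _ _ fun w₂' h =>
      codebookMean_same_cloud hPA1 hK1 hQB1 hL1 w₁ h wc wp G₂,
    sum_erase_eq_of_const w₂ _ _ fun w₂' h => sum_erase_eq_of_const wc _ _ fun wc' h' =>
      codebookMean_same_cloud_other_cloud hPA1 hK1 hQB1 hL1 w₁ h h' wp G₃,
    sum_erase_eq_of_const wp _ _ fun wp' h =>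
      codebookMean_second_same_cloud hPA1 hK1 hQB1 hL1 w₁ w₂ wc h G₄,
    sum_erase_eq_of_const wc _ _ fun wc' h =>
      (Finset.sum_congr rfl fun wp' _ =>
        codebookMean_second_other_cloud hPA1 hK1 hQB1 hL1 w₁ w₂ h wp wp' G₅).trans
        ((Finset.sum_const _).trans (nsmul_eq_mul _ _))]
  rfl

end TwoTransmitters

end RandomCoding

/-! ### Threshold decoding -/

/-- The indicator of a proposition, as a real number. -/
noncomputable def boolInd (P : Prop) : ℝ := open Classical in if P then 1 else 0

theorem boolInd_of {P : Prop} (h : P) : boolInd P = 1 := by simp [boolInd, h]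

theorem boolInd_nonneg (P : Prop) : 0 ≤ boolInd P := by unfold boolInd; split_ifs <;> norm_num

theorem one_le_sum_boolInd {S : Type*} {s : Finset S} {P : S → Prop} {i : S} (hi : i ∈ s)
    (h : P i) : 1 ≤ ∑ j ∈ s, boolInd (P j) := by
  rw [← boolInd_of h]
  exact Finset.single_le_sum (f := fun j => boolInd (P j)) (fun _ _ => boolInd_nonneg _) hi

/-- When no candidate passes the value is arbitrary; only outputs with a unique passing candidate
matter. -/
theorem exists_unique_decoder {Y W : Type*} [Nonempty W] (T : Y → W → Prop) :
    ∃ g : Y → W, ∀ y w, T y w → (∀ w', T y w' → w' = w) → g y = w := by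
  classical
  refine ⟨fun y => if h : ∃ w, T y w then h.choose else Classical.arbitrary W, fun y w hw hu => ?_⟩
  have h : ∃ w, T y w := ⟨w, hw⟩
  simp only [dif_pos h]
  exact hu _ h.choose_spec

namespace BIC

variable {X₁ X₂ Y₁ Y₂ Y₃ : Type*} [Fintype Y₁] [Fintype Y₂] [Fintype Y₃]

theorem trans_nonneg (ch : BIC X₁ X₂ Y₁ Y₂ Y₃) (x₁ : X₁) (x₂ : X₂) (y₁ : Y₁) (y₂ : Y₂) (y₃ : Y₃) :
    0 ≤ ch.trans x₁ x₂ y₁ y₂ y₃ :=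
  mul_nonneg (mul_nonneg ((ch.W₁_mem x₁).1 y₁) ((ch.W₂_mem x₁ x₂).1 y₂)) ((ch.W₃_mem x₂).1 y₃)

theorem sum_trans (ch : BIC X₁ X₂ Y₁ Y₂ Y₃) (x₁ : X₁) (x₂ : X₂) :
    ∑ y : Y₁ × Y₂ × Y₃, ch.trans x₁ x₂ y.1 y.2.1 y.2.2 = 1 := by
  simp only [Fintype.sum_prod_type, trans, ← Finset.mul_sum, (ch.W₃_mem x₂).2, mul_one,
    (ch.W₂_mem x₁ x₂).2, (ch.W₁_mem x₁).2]

/-- The transition probability of `n` memoryless uses of the channel. -/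
def blockTrans (ch : BIC X₁ X₂ Y₁ Y₂ Y₃) {n : ℕ} (x : Fin n → X₁) (z : Fin n → X₂)
    (y : (Fin n → Y₁) × (Fin n → Y₂) × (Fin n → Y₃)) : ℝ :=
  ∏ i, ch.trans (x i) (z i) (y.1 i) (y.2.1 i) (y.2.2 i)

/-- Two superposition codebooks with threshold tests for the three receivers yield a code whose
error probability obeys the union bound. -/
theorem exists_code_of_codebooks (ch : BIC X₁ X₂ Y₁ Y₂ Y₃) {n : ℕ} {A B : Type*}
    {M₁ M₂ Mc Mp : ℕ} (h₁ : 0 < M₁) (h₂ : 0 < M₂) (hc : 0 < Mc) (hp : 0 < Mp)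
    (c : Fin M₁ → A × (Fin M₂ → Fin n → X₁)) (d : Fin Mc → B × (Fin Mp → Fin n → X₂))
    (T₁ : A → (Fin n → Y₁) → Prop) (T₂ : A → (Fin n → Y₂) → Prop)
    (T₃ T₄ : A → (Fin n → X₁) → B → (Fin n → Y₂) → Prop)
    (T₅ : B → (Fin n → X₂) → (Fin n → Y₃) → Prop) (T₆ : (Fin n → X₂) → (Fin n → Y₃) → Prop) :
    ∃ C : BICCode X₁ X₂ Y₁ Y₂ Y₃ n, C.M₁ = M₁ ∧ C.M₂ = M₂ ∧ C.M₃ = Mc * Mp ∧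
      Fintype.card (Fin M₁ × Fin M₂ × Fin Mc × Fin Mp) * ch.errorProb C ≤
      ∑ w : Fin M₁ × Fin M₂ × Fin Mc × Fin Mp,
        ∑ y, ch.blockTrans ((c w.1).2 w.2.1) ((d w.2.2.1).2 w.2.2.2) y *
          ((boolInd (¬ T₁ (c w.1).1 y.1) + boolInd (¬ T₂ (c w.1).1 y.2.1)
            + boolInd (¬ T₃ (c w.1).1 ((c w.1).2 w.2.1) (d w.2.2.1).1 y.2.1)
            + boolInd (¬ T₄ (c w.1).1 ((c w.1).2 w.2.1) (d w.2.2.1).1 y.2.1)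
            + boolInd (¬ T₅ (d w.2.2.1).1 ((d w.2.2.1).2 w.2.2.2) y.2.2)
            + boolInd (¬ T₆ ((d w.2.2.1).2 w.2.2.2) y.2.2))
          + ∑ w₁' ∈ Finset.univ.erase w.1,
              (boolInd (T₁ (c w₁').1 y.1) + boolInd (T₂ (c w₁').1 y.2.1))
          + ∑ w₂' ∈ Finset.univ.erase w.2.1,
              boolInd (T₃ (c w.1).1 ((c w.1).2 w₂') (d w.2.2.1).1 y.2.1)
          + ∑ w₂' ∈ Finset.univ.erase w.2.1, ∑ wc' ∈ Finset.univ.erase w.2.2.1,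
              boolInd (T₄ (c w.1).1 ((c w.1).2 w₂') (d wc').1 y.2.1)
          + ∑ wp' ∈ Finset.univ.erase w.2.2.2,
              boolInd (T₅ (d w.2.2.1).1 ((d w.2.2.1).2 wp') y.2.2)
          + ∑ wc' ∈ Finset.univ.erase w.2.2.1, ∑ wp', boolInd (T₆ ((d wc').2 wp') y.2.2)) := by
  have : Nonempty (Fin M₁) := ⟨⟨0, h₁⟩⟩
  have : Nonempty (Fin M₂) := ⟨⟨0, h₂⟩⟩
  have : Nonempty (Fin Mc) := ⟨⟨0, hc⟩⟩
  have : Nonempty (Fin Mp) := ⟨⟨0, hp⟩⟩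
  obtain ⟨g₁, hg₁⟩ := exists_unique_decoder (fun y (w : Fin M₁) => T₁ (c w).1 y)
  -- The indices `w₁` and `wc` are only required to exist: uniqueness is asked of `w₂` alone.
  obtain ⟨g₂, hg₂⟩ := exists_unique_decoder (fun y (w : Fin M₂) => ∃ w₁ wc,
    T₂ (c w₁).1 y ∧ T₃ (c w₁).1 ((c w₁).2 w) (d wc).1 y ∧ T₄ (c w₁).1 ((c w₁).2 w) (d wc).1 y)
  obtain ⟨g₃, hg₃⟩ := exists_unique_decoder (fun y (w : Fin Mc × Fin Mp) =>
    T₅ (d w.1).1 ((d w.1).2 w.2) y ∧ T₆ ((d w.1).2 w.2) y)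
  refine ⟨⟨M₁, M₂, Mc * Mp, h₁, h₂, Nat.mul_pos hc hp, fun w => (c w.1).2 w.2,
    fun w => (d (finProdFinEquiv.symm w).1).2 (finProdFinEquiv.symm w).2, g₁, g₂,
    fun y => finProdFinEquiv (g₃ y)⟩, rfl, rfl, rfl, ?_⟩
  unfold errorProb
  have hcard : (Fintype.card (Fin M₁ × Fin M₂ × Fin Mc × Fin Mp) : ℝ) =
      (M₁ : ℝ) * M₂ * ((Mc * Mp : ℕ) : ℝ) := by
    simp only [Fintype.card_prod, Fintype.card_fin]; push_cast; ring
  have hne : (M₁ : ℝ) * M₂ * ((Mc * Mp : ℕ) : ℝ) ≠ 0 := by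
    have := Nat.mul_pos hc hp
    positivity
  rw [hcard, mul_div_cancel₀ _ hne]
  simp only [Fintype.sum_prod_type (α₁ := Fin _)]
  refine Finset.sum_le_sum fun w₁ _ => Finset.sum_le_sum fun w₂ _ => ?_
  -- The message of transmitter 2 is read as the pair of its cloud and satellite indices.
  rw [← Equiv.sum_comp finProdFinEquiv, Fintype.sum_prod_type]
  refine Finset.sum_le_sum fun wc _ => Finset.sum_le_sum fun wp _ => ?_
  rw [Fintype.sum_prod_type]
  refine Finset.sum_le_sum fun y₁ _ => ?_
  rw [Fintype.sum_prod_type]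
  refine Finset.sum_le_sum fun y₂ _ => Finset.sum_le_sum fun y₃ _ => ?_
  simp only [Equiv.symm_apply_apply, ne_eq, EmbeddingLike.apply_eq_iff_eq]
  have hT : 0 ≤ ch.blockTrans ((c w₁).2 w₂) ((d wc).2 wp) (y₁, y₂, y₃) :=
    Finset.prod_nonneg fun i _ => ch.trans_nonneg _ _ _ _ _
  have hs : ∀ {S : Type} (s : Finset S) (P : S → Prop), 0 ≤ ∑ j ∈ s, boolInd (P j) :=
    fun s P => Finset.sum_nonneg fun _ _ => boolInd_nonneg _
  have n1 := boolInd_nonneg (¬ T₁ (c w₁).1 y₁)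
  have n2 := boolInd_nonneg (¬ T₂ (c w₁).1 y₂)
  have n3 := boolInd_nonneg (¬ T₃ (c w₁).1 ((c w₁).2 w₂) (d wc).1 y₂)
  have n4 := boolInd_nonneg (¬ T₄ (c w₁).1 ((c w₁).2 w₂) (d wc).1 y₂)
  have n5 := boolInd_nonneg (¬ T₅ (d wc).1 ((d wc).2 wp) y₃)
  have n6 := boolInd_nonneg (¬ T₆ ((d wc).2 wp) y₃)
  have m1 := hs (Finset.univ.erase w₁) (fun w => T₁ (c w).1 y₁)
  have m2 := hs (Finset.univ.erase w₁) (fun w => T₂ (c w).1 y₂)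
  have m3 := hs (Finset.univ.erase w₂) (fun w => T₃ (c w₁).1 ((c w₁).2 w) (d wc).1 y₂)
  have m4 : 0 ≤ ∑ w₂' ∈ Finset.univ.erase w₂, ∑ wc' ∈ Finset.univ.erase wc,
      boolInd (T₄ (c w₁).1 ((c w₁).2 w₂') (d wc').1 y₂) := Finset.sum_nonneg fun _ _ => hs _ _
  have m5 := hs (Finset.univ.erase wp) (fun w => T₅ (d wc).1 ((d wc).2 w) y₃)
  have m6 : 0 ≤ ∑ wc' ∈ Finset.univ.erase wc, ∑ wp' : Fin Mp,
      boolInd (T₆ ((d wc').2 wp') y₃) := Finset.sum_nonneg fun _ _ => hs _ _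
  rw [Finset.sum_add_distrib]
  split_ifs with herr
  swap
  · exact mul_nonneg hT (by positivity)
  refine le_mul_of_one_le_right hT ?_
  by_cases t1 : T₁ (c w₁).1 y₁
  swap
  · rw [boolInd_of t1]; linarith
  by_cases t2 : T₂ (c w₁).1 y₂
  swap
  · rw [boolInd_of t2]; linarith
  by_cases t3 : T₃ (c w₁).1 ((c w₁).2 w₂) (d wc).1 y₂
  swap
  · rw [boolInd_of t3]; linarith
  by_cases t4 : T₄ (c w₁).1 ((c w₁).2 w₂) (d wc).1 y₂
  swap
  · rw [boolInd_of t4]; linarith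
  by_cases t5 : T₅ (d wc).1 ((d wc).2 wp) y₃
  swap
  · rw [boolInd_of t5]; linarith
  by_cases t6 : T₆ ((d wc).2 wp) y₃
  swap
  · rw [boolInd_of t6]; linarith
  rcases herr with h | h | h
  · obtain ⟨w', hw', hne⟩ : ∃ w', T₁ (c w').1 y₁ ∧ w' ≠ w₁ := by
      by_contra! hcon; exact h (hg₁ y₁ w₁ t1 hcon)
    have := one_le_sum_boolInd (P := fun w => T₁ (c w).1 y₁)
      (Finset.mem_erase.2 ⟨hne, Finset.mem_univ _⟩) hw'
    linarith
  · obtain ⟨w', ⟨v, u, hv2, hv3, hv4⟩, hne⟩ : ∃ w', (∃ w₁ wc, T₂ (c w₁).1 y₂ ∧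
        T₃ (c w₁).1 ((c w₁).2 w') (d wc).1 y₂ ∧ T₄ (c w₁).1 ((c w₁).2 w') (d wc).1 y₂) ∧
        w' ≠ w₂ := by
      by_contra! hcon; exact h (hg₂ y₂ w₂ ⟨w₁, wc, t2, t3, t4⟩ hcon)
    -- A wrong cloud of transmitter 1 is charged to `T₂` alone. With the right one, the wrong `w₂`
    -- is charged to `T₃` or `T₄` according to whether `wc` is right.
    rcases eq_or_ne v w₁ with rfl | hv
    · rcases eq_or_ne u wc with rfl | hu
      · have := one_le_sum_boolInd (P := fun w => T₃ (c v).1 ((c v).2 w) (d u).1 y₂)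
          (Finset.mem_erase.2 ⟨hne, Finset.mem_univ _⟩) hv3
        linarith
      · have h1 := one_le_sum_boolInd (P := fun k => T₄ (c v).1 ((c v).2 w') (d k).1 y₂)
          (Finset.mem_erase.2 ⟨hu, Finset.mem_univ _⟩) hv4
        have h2 := Finset.single_le_sum (f := fun w₂' => ∑ wc' ∈ Finset.univ.erase wc,
          boolInd (T₄ (c v).1 ((c v).2 w₂') (d wc').1 y₂)) (fun _ _ => hs _ _)
          (Finset.mem_erase.2 ⟨hne, Finset.mem_univ _⟩)
        have h3 := h1.trans h2
        linarith
    · have := one_le_sum_boolInd (P := fun w => T₂ (c w).1 y₂)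
        (Finset.mem_erase.2 ⟨hv, Finset.mem_univ _⟩) hv2
      linarith
  · obtain ⟨⟨u, v⟩, ⟨hv5, hv6⟩, hne⟩ : ∃ w' : Fin Mc × Fin Mp,
        (T₅ (d w'.1).1 ((d w'.1).2 w'.2) y₃ ∧ T₆ ((d w'.1).2 w'.2) y₃) ∧ w' ≠ (wc, wp) := by
      by_contra! hcon; exact h (hg₃ y₃ (wc, wp) ⟨t5, t6⟩ hcon)
    rcases eq_or_ne u wc with rfl | hu
    · have hv : v ≠ wp := fun e => hne (by rw [e])
      have := one_le_sum_boolInd (P := fun w => T₅ (d u).1 ((d u).2 w) y₃)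
        (Finset.mem_erase.2 ⟨hv, Finset.mem_univ _⟩) hv5
      linarith
    · have h1 := one_le_sum_boolInd (P := fun k => T₆ ((d u).2 k) y₃) (Finset.mem_univ v) hv6
      have h2 := Finset.single_le_sum (f := fun wc' => ∑ wp' : Fin Mp,
          boolInd (T₆ ((d wc').2 wp') y₃)) (fun _ _ => hs _ _)
          (Finset.mem_erase.2 ⟨hu, Finset.mem_univ _⟩)
      have h3 := h1.trans h2
      linarith

end BIC

/-! ### Information density tests on blocks -/

section DensityTest

variable {Ω α β γ τ : Type*} [Fintype Ω]

/-- The block `(a,b,c)` passes the test when its likelihood ratio is at least `2 ^ (n g)`. -/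
def DensityTest (p : Ω → ℝ) (A : Ω → α) (B : Ω → β) (C : Ω → γ) (g : ℝ) {n : ℕ}
    (a : Fin n → α) (b : Fin n → β) (c : Fin n → γ) : Prop :=
  (2 : ℝ) ^ (n * g) ≤ ∏ i, infoRatio p A B C (a i) (b i) (c i)

/-- The probability that an independent sample of length `n` from `p` fails the test. -/
noncomputable def densityTail (p : Ω → ℝ) (A : Ω → α) (B : Ω → β) (C : Ω → γ) (g : ℝ) (n : ℕ) : ℝ :=
  ∑ ω : Fin n → Ω, (∏ i, p (ω i)) * boolInd (¬ DensityTest p A B C g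
    (fun i => A (ω i)) (fun i => B (ω i)) (fun i => C (ω i)))

theorem tendsto_densityTail [Fintype α] [Fintype β] [Fintype γ] {p : Ω → ℝ} (hp : ∀ ω, 0 ≤ p ω)
    (hp1 : ∑ ω, p ω = 1) (A : Ω → α) (B : Ω → β) (C : Ω → γ) {g : ℝ}
    (hg : g < condMutualInfo p A B C) :
    Tendsto (densityTail p A B C g) atTop (𝓝 0) := by
  rw [condMutualInfo_eq_sum] at hg
  obtain ⟨c, hc0, hc1, hc⟩ := exists_sum_prod_lt_le_pow hp hp1
    (fun ω h => infoRatio_pos hp A B C h) hg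
  refine squeeze_zero (fun n => Finset.sum_nonneg fun ω _ =>
    mul_nonneg (Finset.prod_nonneg fun i _ => hp _) (boolInd_nonneg _)) (fun n => ?_)
    (tendsto_pow_atTop_nhds_zero_of_lt_one hc0 hc1)
  refine le_trans (le_of_eq ?_) (hc n)
  refine Finset.sum_congr rfl fun ω _ => ?_
  congr 1
  unfold boolInd DensityTest
  split_ifs <;> rfl

theorem sum_decoupled_densityTest_le [Fintype α] [Fintype β] [Fintype γ] [Fintype τ] {n : ℕ}
    {p : Ω → ℝ} (hp : ∀ ω, 0 ≤ p ω) (hp1 : ∑ ω, p ω = 1)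
    (A : Ω → α) (B : Ω → β) (C : Ω → γ) (κ : γ → τ → ℝ) (hκ0 : ∀ c t, 0 ≤ κ c t) (φ : τ → α)
    (hκ : ∀ g : α → γ → ℝ,
      ∑ ω, p ω * g (A ω) (C ω) = ∑ ω, p ω * ∑ t, κ (C ω) t * g (φ t) (C ω)) (g : ℝ) :
    ∑ ω : Fin n → Ω, (∏ i, p (ω i)) * ∑ t : Fin n → τ, (∏ i, κ (C (ω i)) (t i)) *
      boolInd (DensityTest p A B C g (fun i => φ (t i)) (fun i => B (ω i)) (fun i => C (ω i)))
      ≤ 2 ^ (-(n * g)) := by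
  refine le_trans (le_of_eq ?_) (sum_decoupled_prod_infoRatio_ge_le hp hp1 A B C κ hκ0 φ hκ g)
  refine Finset.sum_congr rfl fun ω _ => ?_
  congr 1

end DensityTest

theorem sum_prod_kernel {α β : Type*} [Fintype β] {K : α → β → ℝ} (hK : ∀ a, ∑ x, K a x = 1)
    {n : ℕ} (a : Fin n → α) : ∑ x : Fin n → β, ∏ i, K (a i) (x i) = 1 := by
  rw [← Fintype.prod_sum, Finset.prod_eq_one fun i _ => hK (a i)]

namespace BIC

/-- The sample space of `(U₁,X₁,U₂,X₂,Y₁,Y₂,Y₃)`. -/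
abbrev Outcome (U₁ X₁ U₂ X₂ Y₁ Y₂ Y₃ : Type*) := U₁ × X₁ × U₂ × X₂ × Y₁ × Y₂ × Y₃

variable {X₁ X₂ Y₁ Y₂ Y₃ U₁ U₂ : Type*} [Fintype X₁] [Fintype X₂] [Fintype Y₁] [Fintype Y₂]
  [Fintype Y₃] [Fintype U₁] [Fintype U₂] (ch : BIC X₁ X₂ Y₁ Y₂ Y₃)
  {PA : U₁ → ℝ} {K : U₁ → X₁ → ℝ} {QB : U₂ → ℝ} {L : U₂ → X₂ → ℝ}

/-- The law `p(u₁) p(x₁|u₁) p(u₂) p(x₂|u₂) p(y₁,y₂,y₃|x₁,x₂)`. -/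
def kernelLaw (PA : U₁ → ℝ) (K : U₁ → X₁ → ℝ) (QB : U₂ → ℝ) (L : U₂ → X₂ → ℝ) :
    Outcome U₁ X₁ U₂ X₂ Y₁ Y₂ Y₃ → ℝ :=
  ch.jointLaw (fun t => PA t.1 * K t.1 t.2) (fun t => QB t.1 * L t.1 t.2)

/-- Memorylessness: the one-shot mean over block alphabets is a mean over `n` independent copies of
the single-letter law. -/
theorem channelMean_block {n : ℕ} (f : (Fin n → U₁) → (Fin n → X₁) → (Fin n → U₂) →
    (Fin n → X₂) → (Fin n → Y₁) × (Fin n → Y₂) × (Fin n → Y₃) → ℝ) :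
    channelMean (fun a : Fin n → U₁ => ∏ i, PA (a i)) (fun a x => ∏ i, K (a i) (x i))
      (fun b : Fin n → U₂ => ∏ i, QB (b i)) (fun b z => ∏ i, L (b i) (z i)) ch.blockTrans f =
    ∑ ω : Fin n → Outcome U₁ X₁ U₂ X₂ Y₁ Y₂ Y₃, (∏ i, ch.kernelLaw PA K QB L (ω i)) *
      f (fun i => (ω i).1) (fun i => (ω i).2.1) (fun i => (ω i).2.2.1) (fun i => (ω i).2.2.2.1)
        (fun i => (ω i).2.2.2.2.1, fun i => (ω i).2.2.2.2.2.1, fun i => (ω i).2.2.2.2.2.2) := by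
  simp only [sum_pi_prod, channelMean, Fintype.sum_prod_type, Finset.mul_sum, kernelLaw, jointLaw,
    blockTrans, Finset.prod_mul_distrib, mul_assoc]

/-! ### Conditional laws of the inputs, and the code at fixed blocklength -/

section Input

variable (hPA0 : ∀ a, 0 ≤ PA a) (hK0 : ∀ a x, 0 ≤ K a x) (hQB0 : ∀ b, 0 ≤ QB b)
  (hL0 : ∀ b z, 0 ≤ L b z)

omit [Fintype X₁] [Fintype X₂] [Fintype U₁] [Fintype U₂] in
include hPA0 hK0 hQB0 hL0 in
theorem kernelLaw_nonneg (ω : Outcome U₁ X₁ U₂ X₂ Y₁ Y₂ Y₃) : 0 ≤ ch.kernelLaw PA K QB L ω :=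
  mul_nonneg (mul_nonneg (mul_nonneg (hPA0 _) (hK0 _ _)) (mul_nonneg (hQB0 _) (hL0 _ _)))
    (ch.trans_nonneg _ _ _ _ _)

theorem sum_kernelLaw_mul (f : U₁ → X₁ → U₂ → X₂ → ℝ) :
    ∑ ω, ch.kernelLaw PA K QB L ω * f ω.1 ω.2.1 ω.2.2.1 ω.2.2.2.1 =
      ∑ a, PA a * ∑ x, K a x * ∑ b, QB b * ∑ z, L b z * f a x b z := by
  have h : ∀ x z r, ∑ y₁, ∑ y₂, ∑ y₃, ch.trans x z y₁ y₂ y₃ * r = r := fun x z r => by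
    have := ch.sum_trans x z
    simp only [Fintype.sum_prod_type] at this
    simp only [← Finset.sum_mul, this, one_mul]
  simp only [Fintype.sum_prod_type, kernelLaw, jointLaw, mul_assoc, ← Finset.mul_sum, h]

variable (hPA1 : ∑ a, PA a = 1) (hK1 : ∀ a, ∑ x, K a x = 1)
  (hQB1 : ∑ b, QB b = 1) (hL1 : ∀ b, ∑ z, L b z = 1)

include hPA1 hK1 hQB1 hL1 in
theorem sum_kernelLaw : ∑ ω, ch.kernelLaw PA K QB L ω = 1 := by
  have := ch.sum_kernelLaw_mul (PA := PA) (K := K) (QB := QB) (L := L) (fun _ _ _ _ => 1)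
  simpa [hL1, hQB1, hK1, hPA1] using this

include hPA1 hK1 hQB1 hL1 in
theorem condLaw_U₁ (g : U₁ → Unit → ℝ) :
    ∑ ω, ch.kernelLaw PA K QB L ω * g ω.1 () =
      ∑ ω, ch.kernelLaw PA K QB L ω * ∑ t : U₁ × X₁, (PA t.1 * K t.1 t.2) * g t.1 () := by
  rw [← Finset.sum_mul, ch.sum_kernelLaw hPA1 hK1 hQB1 hL1, one_mul,
    ch.sum_kernelLaw_mul (fun a _ _ _ => g a ())]
  simp only [Fintype.sum_prod_type, mul_assoc, ← Finset.mul_sum, ← Finset.sum_mul, hL1, hQB1, hK1,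
    one_mul]

include hK1 hL1 in
theorem condLaw_X₁ (g : X₁ → U₁ × U₂ → ℝ) :
    ∑ ω, ch.kernelLaw PA K QB L ω * g ω.2.1 (ω.1, ω.2.2.1) =
      ∑ ω, ch.kernelLaw PA K QB L ω * ∑ x, K ω.1 x * g x (ω.1, ω.2.2.1) := by
  rw [ch.sum_kernelLaw_mul (fun a x b _ => g x (a, b)),
    ch.sum_kernelLaw_mul (fun a _ b _ => ∑ x, K a x * g x (a, b))]
  simp only [← Finset.sum_mul, hL1, hK1, one_mul]
  refine Finset.sum_congr rfl fun a _ => ?_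
  rw [sum_mul_sum_mul_comm]

include hK1 hQB1 hL1 in
-- The transmitters are independent, so given `U₁` the pair `(X₁, U₂)` has a product law. The extra
-- `X₂` in the kernel is the satellite attached to a wrong centre.
theorem condLaw_X₁_U₂ (g : X₁ × U₂ → U₁ → ℝ) :
    ∑ ω, ch.kernelLaw PA K QB L ω * g (ω.2.1, ω.2.2.1) ω.1 =
      ∑ ω, ch.kernelLaw PA K QB L ω * ∑ t : X₁ × U₂ × X₂,
        (K ω.1 t.1 * (QB t.2.1 * L t.2.1 t.2.2)) * g (t.1, t.2.1) ω.1 := by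
  rw [ch.sum_kernelLaw_mul (fun a x b _ => g (x, b) a),
    ch.sum_kernelLaw_mul (fun a _ _ _ => ∑ t : X₁ × U₂ × X₂,
        (K a t.1 * (QB t.2.1 * L t.2.1 t.2.2)) * g (t.1, t.2.1) a)]
  simp only [Fintype.sum_prod_type, mul_assoc, ← Finset.mul_sum, ← Finset.sum_mul, hL1, hQB1, hK1,
    one_mul]

include hL1 in
theorem condLaw_X₂ (g : X₂ → U₂ → ℝ) :
    ∑ ω, ch.kernelLaw PA K QB L ω * g ω.2.2.2.1 ω.2.2.1 =
      ∑ ω, ch.kernelLaw PA K QB L ω * ∑ z, L ω.2.2.1 z * g z ω.2.2.1 := by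
  rw [ch.sum_kernelLaw_mul (fun _ _ b z => g z b),
    ch.sum_kernelLaw_mul (fun _ _ b _ => ∑ z, L b z * g z b)]
  simp only [← Finset.sum_mul, hL1, one_mul]

include hPA1 hK1 hQB1 hL1 in
theorem marginalLaw_X₂ (g : X₂ → Unit → ℝ) :
    ∑ ω, ch.kernelLaw PA K QB L ω * g ω.2.2.2.1 () =
      ∑ ω, ch.kernelLaw PA K QB L ω * ∑ t : U₂ × X₂, (QB t.1 * L t.1 t.2) * g t.2 () := by
  rw [← Finset.sum_mul, ch.sum_kernelLaw hPA1 hK1 hQB1 hL1, one_mul,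
    ch.sum_kernelLaw_mul (fun _ _ _ z => g z ())]
  simp only [Fintype.sum_prod_type, mul_assoc, ← Finset.mul_sum, ← Finset.sum_mul, hK1,
    hPA1, one_mul]

include hPA1 hK1 hQB1 hL1 hPA0 hK0 hQB0 hL0 in
/-- Random superposition coding with information density tests, for a fixed blocklength. -/
theorem exists_code {n M₁ M₂ Mc Mp : ℕ} (h₁ : 0 < M₁) (h₂ : 0 < M₂) (hc : 0 < Mc) (hp : 0 < Mp)
    (g₁ g₂ g₃ g₄ g₅ g₆ : ℝ) :
    let p : Outcome U₁ X₁ U₂ X₂ Y₁ Y₂ Y₃ → ℝ := ch.kernelLaw PA K QB L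
    ∃ C : BICCode X₁ X₂ Y₁ Y₂ Y₃ n, C.M₁ = M₁ ∧ C.M₂ = M₂ ∧ C.M₃ = Mc * Mp ∧
      ch.errorProb C ≤
        (densityTail p (fun ω => ω.1) (fun ω => ω.2.2.2.2.1) (fun _ => ()) g₁ n
        + densityTail p (fun ω => ω.1) (fun ω => ω.2.2.2.2.2.1) (fun _ => ()) g₂ n
        + densityTail p (fun ω => ω.2.1) (fun ω => ω.2.2.2.2.2.1) (fun ω => (ω.1, ω.2.2.1)) g₃ n
        + densityTail p (fun ω => (ω.2.1, ω.2.2.1)) (fun ω => ω.2.2.2.2.2.1) (fun ω => ω.1) g₄ n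
        + densityTail p (fun ω => ω.2.2.2.1) (fun ω => ω.2.2.2.2.2.2) (fun ω => ω.2.2.1) g₅ n
        + densityTail p (fun ω => ω.2.2.2.1) (fun ω => ω.2.2.2.2.2.2) (fun _ => ()) g₆ n)
        + ((M₁ - 1 : ℕ) : ℝ) * (2 ^ (-(n * g₁)) + 2 ^ (-(n * g₂)))
        + ((M₂ - 1 : ℕ) : ℝ) * 2 ^ (-(n * g₃))
        + ((M₂ - 1 : ℕ) : ℝ) * (((Mc - 1 : ℕ) : ℝ) * 2 ^ (-(n * g₄)))
        + ((Mp - 1 : ℕ) : ℝ) * 2 ^ (-(n * g₅))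
        + ((Mc - 1 : ℕ) : ℝ) * (Mp * 2 ^ (-(n * g₆))) := by
  intro p
  have hp0 : ∀ ω, 0 ≤ p ω := ch.kernelLaw_nonneg hPA0 hK0 hQB0 hL0
  have hp1 : ∑ ω, p ω = 1 := ch.sum_kernelLaw hPA1 hK1 hQB1 hL1
  set T₁ : (Fin n → U₁) → (Fin n → Y₁) → Prop := fun a y =>
    DensityTest p (fun ω => ω.1) (fun ω => ω.2.2.2.2.1) (fun _ => ()) g₁ a y (fun _ => ()) with hT₁
  set T₂ : (Fin n → U₁) → (Fin n → Y₂) → Prop := fun a y =>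
    DensityTest p (fun ω => ω.1) (fun ω => ω.2.2.2.2.2.1) (fun _ => ()) g₂ a y (fun _ => ()) with hT₂
  set T₃ : (Fin n → U₁) → (Fin n → X₁) → (Fin n → U₂) → (Fin n → Y₂) → Prop := fun a x b y =>
    DensityTest p (fun ω => ω.2.1) (fun ω => ω.2.2.2.2.2.1) (fun ω => (ω.1, ω.2.2.1)) g₃
      x y (fun i => (a i, b i)) with hT₃
  set T₄ : (Fin n → U₁) → (Fin n → X₁) → (Fin n → U₂) → (Fin n → Y₂) → Prop := fun a x b y =>
    DensityTest p (fun ω => (ω.2.1, ω.2.2.1)) (fun ω => ω.2.2.2.2.2.1) (fun ω => ω.1) g₄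
      (fun i => (x i, b i)) y a with hT₄
  set T₅ : (Fin n → U₂) → (Fin n → X₂) → (Fin n → Y₃) → Prop := fun b z y =>
    DensityTest p (fun ω => ω.2.2.2.1) (fun ω => ω.2.2.2.2.2.2) (fun ω => ω.2.2.1) g₅
      z y b with hT₅
  set T₆ : (Fin n → X₂) → (Fin n → Y₃) → Prop := fun z y =>
    DensityTest p (fun ω => ω.2.2.2.1) (fun ω => ω.2.2.2.2.2.2) (fun _ => ()) g₆
      z y (fun _ => ()) with hT₆
  obtain ⟨c, d, hcd⟩ := exists_superposition_codebooks (W₁ := Fin M₁) (W₂ := Fin M₂)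
    (Wc := Fin Mc) (Wp := Fin Mp) (PA := fun a : Fin n → U₁ => ∏ i, PA (a i))
    (K := fun a (x : Fin n → X₁) => ∏ i, K (a i) (x i)) (QB := fun b : Fin n → U₂ => ∏ i, QB (b i))
    (L := fun b (z : Fin n → X₂) => ∏ i, L (b i) (z i)) (T := ch.blockTrans)
    (sum_iid hPA1) (sum_prod_kernel hK1) (sum_iid hQB1) (sum_prod_kernel hL1)
    (fun _ => Finset.prod_nonneg fun _ _ => hPA0 _)
    (fun _ _ => Finset.prod_nonneg fun _ _ => hK0 _ _)
    (fun _ => Finset.prod_nonneg fun _ _ => hQB0 _)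
    (fun _ _ => Finset.prod_nonneg fun _ _ => hL0 _ _)
    (fun a x b z y => boolInd (¬ T₁ a y.1) + boolInd (¬ T₂ a y.2.1) + boolInd (¬ T₃ a x b y.2.1)
      + boolInd (¬ T₄ a x b y.2.1) + boolInd (¬ T₅ b z y.2.2) + boolInd (¬ T₆ z y.2.2))
    (fun a y => boolInd (T₁ a y.1) + boolInd (T₂ a y.2.1))
    (fun a x b y => boolInd (T₃ a x b y.2.1)) (fun a x b y => boolInd (T₄ a x b y.2.1))
    (fun b z y => boolInd (T₅ b z y.2.2)) (fun z y => boolInd (T₆ z y.2.2))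
  obtain ⟨C, hC₁, hC₂, hC₃, hC⟩ := ch.exists_code_of_codebooks h₁ h₂ hc hp c d T₁ T₂ T₃ T₄ T₅ T₆
  refine ⟨C, hC₁, hC₂, hC₃, ?_⟩
  have hcard : (0 : ℝ) < Fintype.card (Fin M₁ × Fin M₂ × Fin Mc × Fin Mp) := by
    simp only [Fintype.card_prod, Fintype.card_fin]; positivity
  refine (le_of_mul_le_mul_left (hC.trans hcd) hcard).trans ?_
  simp only [Fintype.card_fin]
  -- `k1` to `k6` bound the chance that a competitor passes each test; each kernel is the law with
  -- which the codebook draws that competitor.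
  have k1 := sum_decoupled_densityTest_le (n := n) hp0 hp1 (fun ω => ω.1) (fun ω => ω.2.2.2.2.1)
    (fun _ => ()) (fun _ (t : U₁ × X₁) => PA t.1 * K t.1 t.2)
    (fun _ _ => mul_nonneg (hPA0 _) (hK0 _ _)) (fun t => t.1)
    (ch.condLaw_U₁ hPA1 hK1 hQB1 hL1) g₁
  have k2 := sum_decoupled_densityTest_le (n := n) hp0 hp1 (fun ω => ω.1) (fun ω => ω.2.2.2.2.2.1)
    (fun _ => ()) (fun _ (t : U₁ × X₁) => PA t.1 * K t.1 t.2)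
    (fun _ _ => mul_nonneg (hPA0 _) (hK0 _ _)) (fun t => t.1)
    (ch.condLaw_U₁ hPA1 hK1 hQB1 hL1) g₂
  have k3 := sum_decoupled_densityTest_le (n := n) hp0 hp1 (fun ω => ω.2.1)
    (fun ω => ω.2.2.2.2.2.1) (fun ω => (ω.1, ω.2.2.1)) (fun s x => K s.1 x)
    (fun _ _ => hK0 _ _) (fun x => x) (ch.condLaw_X₁ hK1 hL1) g₃
  have k4 := sum_decoupled_densityTest_le (n := n) hp0 hp1 (fun ω => (ω.2.1, ω.2.2.1))
    (fun ω => ω.2.2.2.2.2.1) (fun ω => ω.1)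
    (fun a (t : X₁ × U₂ × X₂) => K a t.1 * (QB t.2.1 * L t.2.1 t.2.2))
    (fun _ _ => mul_nonneg (hK0 _ _) (mul_nonneg (hQB0 _) (hL0 _ _))) (fun t => (t.1, t.2.1))
    (ch.condLaw_X₁_U₂ hK1 hQB1 hL1) g₄
  have k5 := sum_decoupled_densityTest_le (n := n) hp0 hp1 (fun ω => ω.2.2.2.1)
    (fun ω => ω.2.2.2.2.2.2) (fun ω => ω.2.2.1) L hL0 (fun z => z)
    (ch.condLaw_X₂ hL1) g₅
  have k6 := sum_decoupled_densityTest_le (n := n) hp0 hp1 (fun ω => ω.2.2.2.1)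
    (fun ω => ω.2.2.2.2.2.2) (fun _ => ()) (fun _ (t : U₂ × X₂) => QB t.1 * L t.1 t.2)
    (fun _ _ => mul_nonneg (hQB0 _) (hL0 _ _)) (fun t => t.2)
    (ch.marginalLaw_X₂ hPA1 hK1 hQB1 hL1) g₆
  simp only [sum_pi_prod (α := U₁) (β := X₁), Finset.prod_mul_distrib] at k1 k2
  simp only [sum_pi_prod (α := X₁) (β := U₂ × X₂), sum_pi_prod (α := U₂) (β := X₂),
    Finset.prod_mul_distrib] at k4
  simp only [sum_pi_prod (α := U₂) (β := X₂), Finset.prod_mul_distrib] at k6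
  simp only [channelMean_block]
  gcongr
  · simp only [mul_add, Finset.sum_add_distrib]
    exact le_rfl
  · simp only [Fintype.sum_prod_type, mul_add, Finset.sum_add_distrib]
    exact add_le_add k1 k2
  · simp only [Fintype.sum_prod_type, Finset.mul_sum, mul_assoc] at k4 ⊢
    exact k4
  · simp only [Fintype.sum_prod_type]
    exact k6

end Input

end BIC

/-! ### Message set sizes -/

/-- The size `⌊2 ^ (n (R - e)⁺)⌋` of a message set of rate `R`, backed off by `e`. -/
noncomputable def messageCount (n : ℕ) (R e : ℝ) : ℕ := ⌊(2 : ℝ) ^ (n * max (R - e) 0)⌋₊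

theorem one_le_two_rpow_rate (n : ℕ) (R e : ℝ) : (1 : ℝ) ≤ 2 ^ (n * max (R - e) 0) :=
  Real.one_le_rpow one_le_two (mul_nonneg n.cast_nonneg (le_max_right _ _))

theorem messageCount_pos (n : ℕ) (R e : ℝ) : 0 < messageCount n R e :=
  Nat.floor_pos.2 (one_le_two_rpow_rate n R e)

theorem messageCount_le_two_rpow (n : ℕ) (R e : ℝ) :
    (messageCount n R e : ℝ) ≤ 2 ^ (n * max (R - e) 0) :=
  Nat.floor_le (Real.rpow_pos_of_pos two_pos _).le

theorem messageCount_eq_one (n : ℕ) {R e : ℝ} (h : R ≤ e) : messageCount n R e = 1 := by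
  simp [messageCount, max_eq_right (sub_nonpos.2 h)]

/-- The subtracted one is the true message. For `R ≤ e` there are no competitors, so the bound holds
even with a negative exponent, where it fails for the full count. -/
theorem messageCount_sub_one_le (n : ℕ) (R e : ℝ) :
    ((messageCount n R e - 1 : ℕ) : ℝ) ≤ 2 ^ (n * (R - e)) := by
  rcases le_total R e with h | h
  · rw [messageCount_eq_one n h]
    simpa using (Real.rpow_pos_of_pos two_pos (n * (R - e))).le
  · have := messageCount_le_two_rpow n R e
    rw [max_eq_left (sub_nonneg.2 h)] at this
    exact le_trans (by exact_mod_cast Nat.sub_le _ _) this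

theorem messageCount_le (n : ℕ) {R e : ℝ} (hR : 0 ≤ R) (he : 0 ≤ e) :
    (messageCount n R e : ℝ) ≤ 2 ^ (n * R) :=
  (messageCount_le_two_rpow n R e).trans (Real.rpow_le_rpow_of_exponent_le one_le_two
    (mul_le_mul_of_nonneg_left (max_le (by linarith) hR) n.cast_nonneg))

theorem abs_rate_messageCount_sub_le {n : ℕ} (hn : 0 < n) {R e : ℝ} (hR : 0 ≤ R) (he : 0 ≤ e) :
    |Real.logb 2 (messageCount n R e) / n - R| ≤ e + 1 / n := by
  have hn' : (0 : ℝ) < n := Nat.cast_pos.2 hn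
  have hM : (0 : ℝ) < messageCount n R e := Nat.cast_pos.2 (messageCount_pos n R e)
  have hup : Real.logb 2 (messageCount n R e) ≤ n * R := by
    rw [Real.logb_le_iff_le_rpow one_lt_two hM]
    exact messageCount_le n hR he
  -- Rounding down a number that is at least 1 loses at most a factor 2, hence one bit.
  have hlow : n * (R - e) - 1 ≤ Real.logb 2 (messageCount n R e) := by
    rw [Real.le_logb_iff_rpow_le one_lt_two hM, Real.rpow_sub two_pos, Real.rpow_one]
    have h1 : (2 : ℝ) ^ (n * (R - e)) ≤ 2 ^ (n * max (R - e) 0) :=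
      Real.rpow_le_rpow_of_exponent_le one_le_two
        (mul_le_mul_of_nonneg_left (le_max_left _ _) hn'.le)
    have h2 : (2 : ℝ) ^ (n * max (R - e) 0) < messageCount n R e + 1 := Nat.lt_floor_add_one _
    have h3 : (1 : ℝ) ≤ messageCount n R e := by exact_mod_cast messageCount_pos n R e
    linarith
  have e1 : Real.logb 2 (messageCount n R e) / n ≤ R := by
    rw [div_le_iff₀ hn']; linarith
  have e2 : R - e - 1 / n ≤ Real.logb 2 (messageCount n R e) / n := by
    rw [le_div_iff₀ hn', sub_mul, one_div, inv_mul_cancel₀ hn'.ne']; linarith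
  rw [abs_le]
  have : 0 ≤ 1 / (n : ℝ) := by positivity
  constructor <;> linarith

/-- Rates are backed off by `e` and thresholds by only `e / 2`, which leaves an exponent of `e / 2`
for the union bound. -/
theorem mul_two_rpow_neg_le (n : ℕ) {m R I e : ℝ} (hm : m ≤ 2 ^ (n * (R - e))) (hR : R ≤ I) :
    m * 2 ^ (-(n * (I - e / 2))) ≤ 2 ^ (-(n * (e / 2))) := by
  refine (mul_le_mul_of_nonneg_right hm (Real.rpow_pos_of_pos two_pos _).le).trans ?_
  rw [← Real.rpow_add two_pos]
  refine Real.rpow_le_rpow_of_exponent_le one_le_two ?_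
  have : (n : ℝ) * R ≤ n * I := mul_le_mul_of_nonneg_left hR n.cast_nonneg
  linarith

theorem tendsto_two_rpow_neg {e : ℝ} (he : 0 < e) :
    Tendsto (fun n : ℕ => (2 : ℝ) ^ (-(n * e))) atTop (𝓝 0) := by
  have h : ∀ n : ℕ, (2 : ℝ) ^ (-(n * e)) = ((2 : ℝ) ^ (-e)) ^ n := fun n => by
    rw [← Real.rpow_natCast, ← Real.rpow_mul two_pos.le]; congr 1; ring
  simp only [h]
  exact tendsto_pow_atTop_nhds_zero_of_lt_one (Real.rpow_pos_of_pos two_pos _).le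
    (Real.rpow_lt_one_of_one_lt_of_neg one_lt_two (by linarith))

/-! ### Disintegration of the input laws -/

theorem exists_kernel_of_mem_stdSimplex {U X : Type*} [Fintype U] [Fintype X] {P : U × X → ℝ}
    (hP : P ∈ stdSimplex ℝ (U × X)) :
    ∃ (PA : U → ℝ) (K : U → X → ℝ), (∀ a, 0 ≤ PA a) ∧ (∀ a x, 0 ≤ K a x) ∧ ∑ a, PA a = 1 ∧
      (∀ a, ∑ x, K a x = 1) ∧ P = fun t => PA t.1 * K t.1 t.2 := by
  classical
  obtain ⟨h0, h1⟩ := hP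
  rw [Fintype.sum_prod_type] at h1
  have hA : ∀ a, 0 ≤ ∑ x, P (a, x) := fun a => Finset.sum_nonneg fun x _ => h0 _
  -- On symbols of mass zero the kernel defaults to the marginal of `X`, a probability law available
  -- without choosing a point.
  refine ⟨fun a => ∑ x, P (a, x),
    fun a x => if ∑ x, P (a, x) = 0 then ∑ a', P (a', x) else P (a, x) / ∑ x, P (a, x),
    hA, fun a x => ?_, h1, fun a => ?_, ?_⟩
  · dsimp only
    split_ifs
    · exact Finset.sum_nonneg fun _ _ => h0 _
    · exact div_nonneg (h0 _) (hA a)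
  · dsimp only
    split_ifs with h
    · rw [Finset.sum_comm, h1]
    · rw [← Finset.sum_div, div_self h]
  · ext ⟨a, x⟩
    dsimp only
    split_ifs with h
    · rw [h, zero_mul]
      exact (Finset.sum_eq_zero_iff_of_nonneg fun x _ => h0 (a, x)).1 h x (Finset.mem_univ _)
    · rw [mul_div_cancel₀ _ h]

/-! ### Achievability -/

/-- Choosing for each `n` an element within `1 / (n + 1)` of the infimum removes the dependence on
`ε`. -/
theorem exists_tendsto_zero_of_eventually_exists_le {α : ℕ → Type*} [∀ n, Nonempty (α n)]
    (Q : (n : ℕ) → α n → ℝ) (h0 : ∀ n a, 0 ≤ Q n a)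
    (h : ∀ ε > 0, ∀ᶠ n in atTop, ∃ a, Q n a ≤ ε) :
    ∃ c : (n : ℕ) → α n, Tendsto (fun n => Q n (c n)) atTop (𝓝 0) := by
  have hbdd : ∀ n, BddBelow (Set.range (Q n)) := fun n => ⟨0, by rintro _ ⟨a, rfl⟩; exact h0 n a⟩
  have hex : ∀ n : ℕ, ∃ a, Q n a < (⨅ a, Q n a) + 1 / ((n : ℝ) + 1) := fun n =>
    exists_lt_of_ciInf_lt (lt_add_of_pos_right _ (by positivity))
  choose c hc using hex
  refine ⟨c, squeeze_zero (fun n => h0 n _) (fun n => (hc n).le) ?_⟩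
  rw [← add_zero (0 : ℝ)]
  refine Tendsto.add ?_ tendsto_one_div_add_atTop_nhds_zero_nat
  rw [Metric.tendsto_atTop']
  intro ε hε
  obtain ⟨N, hN⟩ := eventually_atTop.1 (h (ε / 2) (by linarith))
  refine ⟨N, fun n hn => ?_⟩
  obtain ⟨a, ha⟩ := hN n hn.le
  have h1 : 0 ≤ ⨅ a, Q n a := le_ciInf (h0 n)
  have h2 : ⨅ a, Q n a ≤ Q n a := ciInf_le (hbdd n) a
  rw [Real.dist_eq, sub_zero, abs_of_nonneg h1]
  linarith

namespace BIC

variable {X₁ X₂ Y₁ Y₂ Y₃ : Type*} [Fintype Y₁] [Fintype Y₂] [Fintype Y₃]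

theorem errorProb_nonneg (ch : BIC X₁ X₂ Y₁ Y₂ Y₃) {n : ℕ} (c : BICCode X₁ X₂ Y₁ Y₂ Y₃ n) :
    0 ≤ ch.errorProb c := by
  classical
  unfold errorProb
  refine div_nonneg ?_ (by positivity)
  refine Finset.sum_nonneg fun _ _ => Finset.sum_nonneg fun _ _ => Finset.sum_nonneg fun _ _ =>
    Finset.sum_nonneg fun _ _ => Finset.sum_nonneg fun _ _ => Finset.sum_nonneg fun _ _ => ?_
  split_ifs
  · exact Finset.prod_nonneg fun _ _ => ch.trans_nonneg _ _ _ _ _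
  · exact le_rfl

/-- The error probability of a code plus the distance of its rates from `R`. -/
noncomputable def codeDefect (ch : BIC X₁ X₂ Y₁ Y₂ Y₃) (R : ℝ × ℝ × ℝ) (n : ℕ)
    (c : BICCode X₁ X₂ Y₁ Y₂ Y₃ n) : ℝ :=
  |Real.logb 2 (c.M₁ : ℝ) / n - R.1| + |Real.logb 2 (c.M₂ : ℝ) / n - R.2.1|
    + |Real.logb 2 (c.M₃ : ℝ) / n - R.2.2| + ch.errorProb c

/-- Rates and error are combined into one number so that a single sequence of near-optimal codes
achieves all four limits. -/
theorem achievable_of_codeDefect (ch : BIC X₁ X₂ Y₁ Y₂ Y₃) [Nonempty X₁] [Nonempty X₂]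
    {R : ℝ × ℝ × ℝ} (h : ∀ ε > 0, ∀ᶠ n in atTop, ∃ c, ch.codeDefect R n c ≤ ε) :
    ch.Achievable R := by
  have : ∀ n, Nonempty (BICCode X₁ X₂ Y₁ Y₂ Y₃ n) := fun n =>
    ⟨⟨1, 1, 1, one_pos, one_pos, one_pos, fun _ _ => Classical.arbitrary _,
      fun _ _ => Classical.arbitrary _, fun _ => 0, fun _ => 0, fun _ => 0⟩⟩
  have hnn : ∀ n (c : BICCode X₁ X₂ Y₁ Y₂ Y₃ n), 0 ≤ ch.errorProb c := fun n c =>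
    ch.errorProb_nonneg c
  obtain ⟨c, hc⟩ := exists_tendsto_zero_of_eventually_exists_le (ch.codeDefect R)
    (fun n c => add_nonneg (by positivity) (hnn n c)) h
  have key : ∀ (f : ℕ → ℝ) (r : ℝ), (∀ n, |f n - r| ≤ ch.codeDefect R n (c n)) →
      Tendsto f atTop (𝓝 r) := fun f r hf =>
    tendsto_iff_dist_tendsto_zero.2 (squeeze_zero (fun _ => dist_nonneg) hf hc)
  refine ⟨c, key _ _ fun n => ?_, key _ _ fun n => ?_, key _ _ fun n => ?_, key _ _ fun n => ?_⟩
  all_goals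
    have h0 := hnn n (c n)
    have h1 := abs_nonneg (Real.logb 2 ((c n).M₁ : ℝ) / n - R.1)
    have h2 := abs_nonneg (Real.logb 2 ((c n).M₂ : ℝ) / n - R.2.1)
    have h3 := abs_nonneg (Real.logb 2 ((c n).M₃ : ℝ) / n - R.2.2)
    unfold codeDefect
  · linarith
  · linarith
  · linarith
  · rw [sub_zero, abs_of_nonneg h0]; linarith

/-- This handles the closure: each of the three rates moves by at most the sup distance. -/
theorem codeDefect_le_of_dist_le (ch : BIC X₁ X₂ Y₁ Y₂ Y₃) {R R' : ℝ × ℝ × ℝ} {n : ℕ}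
    (c : BICCode X₁ X₂ Y₁ Y₂ Y₃ n) :
    ch.codeDefect R n c ≤ ch.codeDefect R' n c + 3 * dist R R' := by
  have h1 : |R'.1 - R.1| ≤ dist R R' := by
    rw [abs_sub_comm, ← Real.dist_eq]; exact le_max_left _ _
  have h2 : |R'.2.1 - R.2.1| ≤ dist R R' := by
    rw [abs_sub_comm, ← Real.dist_eq]; exact (le_max_left _ _).trans (le_max_right _ _)
  have h3 : |R'.2.2 - R.2.2| ≤ dist R R' := by
    rw [abs_sub_comm, ← Real.dist_eq]; exact (le_max_right _ _).trans (le_max_right _ _)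
  have t1 := abs_sub_le (Real.logb 2 (c.M₁ : ℝ) / n) R'.1 R.1
  have t2 := abs_sub_le (Real.logb 2 (c.M₂ : ℝ) / n) R'.2.1 R.2.1
  have t3 := abs_sub_le (Real.logb 2 (c.M₃ : ℝ) / n) R'.2.2 R.2.2
  unfold codeDefect
  linarith

variable [Fintype X₁] [Fintype X₂]

/-- Summing out `U₂` gives the law for which the less noisy condition is stated. -/
theorem lawOf_jointLaw (ch : BIC X₁ X₂ Y₁ Y₂ Y₃) {U₁ U₂ : Type*} [Fintype U₁] [Fintype U₂]
    (P : U₁ × X₁ → ℝ) (Q : U₂ × X₂ → ℝ) :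
    lawOf (ch.jointLaw P Q) (fun ω : Outcome U₁ X₁ U₂ X₂ Y₁ Y₂ Y₃ =>
      (ω.1, ω.2.1, ω.2.2.2)) = ch.law P (fun x₂ => ∑ u₂, Q (u₂, x₂)) := by
  classical
  funext t
  let e : Outcome U₁ X₁ U₂ X₂ Y₁ Y₂ Y₃ ≃ U₂ × (U₁ × X₁ × X₂ × Y₁ × Y₂ × Y₃) :=
    ⟨fun ω => (ω.2.2.1, (ω.1, ω.2.1, ω.2.2.2)), fun s => (s.2.1, s.2.2.1, s.1, s.2.2.2),
      fun _ => rfl, fun _ => rfl⟩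
  rw [lawOf_eq_sum, ← e.symm.sum_comp, Fintype.sum_prod_type]
  have h : ∀ s : U₂ × (U₁ × X₁ × X₂ × Y₁ × Y₂ × Y₃),
      ((e.symm s).1, (e.symm s).2.1, (e.symm s).2.2.2) = s.2 := fun _ => rfl
  simp only [h, mul_ite, mul_one, mul_zero, Finset.sum_ite_eq', Finset.mem_univ, if_true]
  obtain ⟨u₁, x₁, x₂, y₁, y₂, y₃⟩ := t
  simp only [law, Finset.mul_sum, Finset.sum_mul]
  rfl

theorem ObliviousLessNoisy.mutualInfo_jointLaw_le {ch : BIC X₁ X₂ Y₁ Y₂ Y₃}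
    (hch : ch.ObliviousLessNoisy) {k : ℕ} {U₂ : Type*} [Fintype U₂] {P : Fin k × X₁ → ℝ}
    {Q : U₂ × X₂ → ℝ} (hP : P ∈ stdSimplex ℝ (Fin k × X₁)) (hQ : Q ∈ stdSimplex ℝ (U₂ × X₂)) :
    mutualInfo (ch.jointLaw P Q) (fun ω => ω.1) (fun ω => ω.2.2.2.2.1) ≤
      mutualInfo (ch.jointLaw P Q) (fun ω => ω.1) (fun ω => ω.2.2.2.2.2.1) := by
  have h := hch k P hP (fun x₂ => ∑ u₂, Q (u₂, x₂))
    ⟨fun x₂ => Finset.sum_nonneg fun u₂ _ => hQ.1 _, by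
      rw [Finset.sum_comm, ← Fintype.sum_prod_type (f := Q)]; exact hQ.2⟩
  rw [← lawOf_jointLaw, mutualInfo_lawOf, mutualInfo_lawOf] at h
  exact h

/-- The fixed-blocklength bound tends to zero once `R₃` is split so that every nonempty error event
has enough exponent. -/
theorem eventually_exists_codeDefect_le (ch : BIC X₁ X₂ Y₁ Y₂ Y₃) (hch : ch.ObliviousLessNoisy)
    {k l : ℕ} {P : Fin k × X₁ → ℝ} (hP : P ∈ stdSimplex ℝ (Fin k × X₁)) {Q : Fin l × X₂ → ℝ}
    (hQ : Q ∈ stdSimplex ℝ (Fin l × X₂)) {R : ℝ × ℝ × ℝ} (hR : R ∈ ch.superpositionBounds P Q)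
    {ε : ℝ} (hε : 0 < ε) : ∀ᶠ n in atTop, ∃ c, ch.codeDefect R n c ≤ ε := by
  obtain ⟨R₁, R₂, R₃⟩ := R
  obtain ⟨hR₁, hR₂, hR₃, hb₁, hb₃, hb₆, hb₄⟩ := hR
  have hb₂ := hb₁.trans (hch.mutualInfo_jointLaw_le hP hQ)
  dsimp only at hR₁ hR₂ hR₃ hb₁ hb₂ hb₃ hb₆ hb₄
  obtain ⟨PA, K, hPA0, hK0, hPA1, hK1, rfl⟩ := exists_kernel_of_mem_stdSimplex hP
  obtain ⟨QB, L, hQB0, hL0, hQB1, hL1, rfl⟩ := exists_kernel_of_mem_stdSimplex hQ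
  set p : Outcome (Fin k) X₁ (Fin l) X₂ Y₁ Y₂ Y₃ → ℝ := ch.kernelLaw PA K QB L with hp
  have hp0 : ∀ ω, 0 ≤ p ω := ch.kernelLaw_nonneg hPA0 hK0 hQB0 hL0
  have hp1 : ∑ ω, p ω = 1 := ch.sum_kernelLaw hPA1 hK1 hQB1 hL1
  set I₁ := condMutualInfo p (fun ω => ω.1) (fun ω => ω.2.2.2.2.1) (fun _ => ()) with hI₁
  set I₂ := condMutualInfo p (fun ω => ω.1) (fun ω => ω.2.2.2.2.2.1) (fun _ => ()) with hI₂
  set I₃ := condMutualInfo p (fun ω => ω.2.1) (fun ω => ω.2.2.2.2.2.1)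
    (fun ω => (ω.1, ω.2.2.1)) with hI₃
  set I₄ := condMutualInfo p (fun ω => (ω.2.1, ω.2.2.1)) (fun ω => ω.2.2.2.2.2.1)
    (fun ω => ω.1) with hI₄
  set I₅ := condMutualInfo p (fun ω => ω.2.2.2.1) (fun ω => ω.2.2.2.2.2.2)
    (fun ω => ω.2.2.1) with hI₅
  set I₆ := condMutualInfo p (fun ω => ω.2.2.2.1) (fun ω => ω.2.2.2.2.2.2) (fun _ => ()) with hI₆
  have b₁ : R₁ ≤ I₁ := by rw [hI₁, ← mutualInfo_eq_condMutualInfo hp1]; exact hb₁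
  have b₂ : R₁ ≤ I₂ := by rw [hI₂, ← mutualInfo_eq_condMutualInfo hp1]; exact hb₂
  have b₃ : R₂ ≤ I₃ := hb₃
  have b₆ : R₃ ≤ I₆ := by rw [hI₆, ← mutualInfo_eq_condMutualInfo hp1]; exact hb₆
  have b₄ : R₂ + R₃ ≤ I₄ + I₅ := hb₄
  -- Here `Rp` is `I₅` clipped to `[0, R₃]`. The bounds are needed only for positive rates, since a
  -- zero rate leaves no competitors; so neither `0 ≤ I₅` nor `R₂ ≤ I₄` has to be proved.
  obtain ⟨Rc, Rp, hRc, hRp, hsum, hRp5, hRc4⟩ : ∃ Rc Rp : ℝ, 0 ≤ Rc ∧ 0 ≤ Rp ∧ Rc + Rp = R₃ ∧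
      (0 < Rp → Rp ≤ I₅) ∧ (0 < Rc → R₂ + Rc ≤ I₄) := by
    rcases le_total I₅ 0 with h | h
    · exact ⟨R₃, 0, hR₃, le_rfl, add_zero _, fun h => absurd h (lt_irrefl _), fun _ => by linarith⟩
    rcases le_total I₅ R₃ with h' | h'
    · exact ⟨R₃ - I₅, I₅, by linarith, h, by ring, fun _ => le_rfl, fun _ => by linarith⟩
    · exact ⟨0, R₃, le_rfl, hR₃, zero_add _, fun _ => h', fun h => absurd h (lt_irrefl _)⟩
  -- The rate errors cost `e + e + 2 * e = ε / 2`, plus `4 / n`; `Rc` and `Rp` each pay once. The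
  -- other half covers that `4 / n`, the tails and the six competitor terms.
  set e : ℝ := ε / 8 with he
  have he0 : 0 < e := by positivity
  set tails : ℕ → ℝ := fun n =>
    densityTail p (fun ω => ω.1) (fun ω => ω.2.2.2.2.1) (fun _ => ()) (I₁ - e / 2) n
    + densityTail p (fun ω => ω.1) (fun ω => ω.2.2.2.2.2.1) (fun _ => ()) (I₂ - e / 2) n
    + densityTail p (fun ω => ω.2.1) (fun ω => ω.2.2.2.2.2.1) (fun ω => (ω.1, ω.2.2.1))
        (I₃ - e / 2) n
    + densityTail p (fun ω => (ω.2.1, ω.2.2.1)) (fun ω => ω.2.2.2.2.2.1) (fun ω => ω.1)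
        (I₄ - e / 2) n
    + densityTail p (fun ω => ω.2.2.2.1) (fun ω => ω.2.2.2.2.2.2) (fun ω => ω.2.2.1)
        (I₅ - e / 2) n
    + densityTail p (fun ω => ω.2.2.2.1) (fun ω => ω.2.2.2.2.2.2) (fun _ => ()) (I₆ - e / 2) n
    with htails
  have hlim : Tendsto (fun n : ℕ => tails n + 6 * (2 : ℝ) ^ (-(n * (e / 2))) + 4 * (1 / (n : ℝ)))
      atTop (𝓝 0) := by
    have h := (((((((tendsto_densityTail hp0 hp1 _ _ _ (sub_lt_self I₁ (half_pos he0))).add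
      (tendsto_densityTail hp0 hp1 _ _ _ (sub_lt_self I₂ (half_pos he0)))).add
      (tendsto_densityTail hp0 hp1 _ _ _ (sub_lt_self I₃ (half_pos he0)))).add
      (tendsto_densityTail hp0 hp1 _ _ _ (sub_lt_self I₄ (half_pos he0)))).add
      (tendsto_densityTail hp0 hp1 _ _ _ (sub_lt_self I₅ (half_pos he0)))).add
      (tendsto_densityTail hp0 hp1 _ _ _ (sub_lt_self I₆ (half_pos he0)))).add
      ((tendsto_two_rpow_neg (half_pos he0)).const_mul 6)).add
      (tendsto_one_div_atTop_nhds_zero_nat.const_mul (4 : ℝ))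
    simpa using h
  filter_upwards [hlim.eventually_lt_const (half_pos hε), eventually_gt_atTop 0] with n hn hn0
  obtain ⟨C, hC₁, hC₂, hC₃, hC⟩ := ch.exists_code hPA0 hK0 hQB0 hL0 hPA1 hK1 hQB1 hL1 (n := n)
    (messageCount_pos n R₁ e) (messageCount_pos n R₂ e) (messageCount_pos n Rc e)
    (messageCount_pos n Rp e) (I₁ - e / 2) (I₂ - e / 2) (I₃ - e / 2) (I₄ - e / 2) (I₅ - e / 2)
    (I₆ - e / 2)
  refine ⟨C, ?_⟩
  have r₁ := abs_rate_messageCount_sub_le hn0 hR₁ he0.le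
  have r₂ := abs_rate_messageCount_sub_le hn0 hR₂ he0.le
  have r₃ : |Real.logb 2 ((messageCount n Rc e * messageCount n Rp e : ℕ) : ℝ) / n - R₃| ≤
      (e + 1 / n) + (e + 1 / n) := by
    rw [Nat.cast_mul, Real.logb_mul (Nat.cast_ne_zero.2 (messageCount_pos n Rc e).ne')
      (Nat.cast_ne_zero.2 (messageCount_pos n Rp e).ne'), ← hsum, add_div, add_sub_add_comm]
    exact (abs_add_le _ _).trans (add_le_add (abs_rate_messageCount_sub_le hn0 hRc he0.le)
      (abs_rate_messageCount_sub_le hn0 hRp he0.le))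
  have q0 : (0 : ℝ) ≤ 2 ^ (-(n * (e / 2))) := (Real.rpow_pos_of_pos two_pos _).le
  have t₁ := mul_two_rpow_neg_le n (messageCount_sub_one_le n R₁ e) b₁
  have t₂ := mul_two_rpow_neg_le n (messageCount_sub_one_le n R₁ e) b₂
  have t₃ := mul_two_rpow_neg_le n (messageCount_sub_one_le n R₂ e) b₃
  have t₄ : ((messageCount n R₂ e - 1 : ℕ) : ℝ) * (((messageCount n Rc e - 1 : ℕ) : ℝ) *
      2 ^ (-(n * (I₄ - e / 2)))) ≤ 2 ^ (-(n * (e / 2))) := by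
    rcases hRc.eq_or_lt with h | h
    · rw [messageCount_eq_one n (h ▸ he0.le : Rc ≤ e)]
      simpa using q0
    rw [← mul_assoc]
    refine mul_two_rpow_neg_le n ?_ (hRc4 h)
    refine (mul_le_mul (messageCount_sub_one_le n R₂ e) (messageCount_sub_one_le n Rc e)
      (Nat.cast_nonneg _) (Real.rpow_pos_of_pos two_pos _).le).trans ?_
    rw [← Real.rpow_add two_pos]
    refine Real.rpow_le_rpow_of_exponent_le one_le_two ?_
    have : (0 : ℝ) ≤ n * e := by positivity
    linarith
  have t₅ : ((messageCount n Rp e - 1 : ℕ) : ℝ) * 2 ^ (-(n * (I₅ - e / 2))) ≤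
      2 ^ (-(n * (e / 2))) := by
    rcases hRp.eq_or_lt with h | h
    · rw [messageCount_eq_one n (h ▸ he0.le : Rp ≤ e)]
      simpa using q0
    exact mul_two_rpow_neg_le n (messageCount_sub_one_le n Rp e) (hRp5 h)
  -- With a wrong cloud every satellite competes, so the full count `Mp` appears and is bounded by
  -- `2 ^ (n * Rp)`; the back-off in `Rc` alone suffices.
  have t₆ : ((messageCount n Rc e - 1 : ℕ) : ℝ) * (messageCount n Rp e *
      2 ^ (-(n * (I₆ - e / 2)))) ≤ 2 ^ (-(n * (e / 2))) := by
    rw [← mul_assoc]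
    refine mul_two_rpow_neg_le n ?_ b₆
    refine (mul_le_mul (messageCount_sub_one_le n Rc e) (messageCount_le n hRp he0.le)
      (Nat.cast_nonneg _) (Real.rpow_pos_of_pos two_pos _).le).trans ?_
    rw [← Real.rpow_add two_pos, ← hsum]
    exact le_of_eq (by ring_nf)
  unfold codeDefect
  rw [hC₁, hC₂, hC₃]
  change ch.errorProb C ≤ tails n + _ + _ + _ + _ + _ at hC
  rw [mul_add] at hC
  have h8 : ε = 8 * e := by rw [he]; ring
  dsimp only
  linarith

end BIC

theorem mainTheorem7 {X₁ X₂ Y₁ Y₂ Y₃ : Type*}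
    [Fintype X₁] [Fintype X₂] [Fintype Y₁] [Fintype Y₂] [Fintype Y₃]
    (ch : BIC X₁ X₂ Y₁ Y₂ Y₃) (hch : ch.ObliviousLessNoisy) :
    ∀ R ∈ ch.superpositionRegion, ch.Achievable R := by
  intro R hR
  have hR' := Metric.mem_closure_iff.1 hR
  -- Any nearby point of the region supplies input laws, which forces both input alphabets to be
  -- nonempty, as codes at every blocklength require.
  obtain ⟨_, ⟨k, l, P, hP, Q, hQ, -⟩, -⟩ := hR' 1 one_pos
  have hnP : Nonempty (Fin k × X₁) := by
    by_contra h
    rw [not_nonempty_iff] at h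
    simpa using hP.2
  have hnQ : Nonempty (Fin l × X₂) := by
    by_contra h
    rw [not_nonempty_iff] at h
    simpa using hQ.2
  have : Nonempty X₁ := hnP.map Prod.snd
  have : Nonempty X₂ := hnQ.map Prod.snd
  refine ch.achievable_of_codeDefect fun ε hε => ?_
  obtain ⟨R', ⟨k, l, P, hP, Q, hQ, hR'⟩, hd⟩ := hR' (ε / 6) (by positivity)
  filter_upwards [ch.eventually_exists_codeDefect_le hch hP hQ hR' (half_pos hε)] with n hn
  obtain ⟨c, hc⟩ := hn
  exact ⟨c, (ch.codeDefect_le_of_dist_le (R' := R') c).trans (by linarith)⟩
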